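/- Let $n\ge 1$, $0<\alpha<2$, and let $\Omega\subseteq\mathbb{R}^n$ be a (bounded or unbounded) domain, i.e. a nonempty connected open set. Write $[\alpha]$ for the integer part of $\alpha$ and $\{\alpha\}=\alpha-[\alpha]$. A function $u:\mathbb{R}^n\to\mathbb{R}$ is called $\alpha$-harmonic in $\Omega$ if (i) $u\in C^{[\alpha],\{\alpha\}+\epsilon}_{loc}(\Omega)$ for some $\epsilon>0$ with $\{\alpha\}+\epsilon<1$; (ii) $u\in\mathcal{L}_\alpha(\mathbb{R}^n)$, i.e. $u$ is measurable and $\int_{\mathbb{R}^n}\frac{|u(x)|}{1+|x|^{n+\alpha}}\,dx<\infty$; (iii) for every $x\in\Omega$, $$(-\Delta)^{\frac{\alpha}{2}}u(x):=C_{n,\alpha}\lim_{\varepsilon\to0^+}\int_{|y-x|\ge\varepsilon}\frac{u(x)-u(y)}{|x-y|^{n+\alpha}}\,dy$$ exists and equals $0$, where $C_{n,\alpha}=\frac{\alpha\,2^{\alpha-1}\,\Gamma(\frac{n+\alpha}{2})}{\pi^{n/2}\,\Gamma(1-\frac{\alpha}{2})}$ is the usual (positive) normalizing constant. **Theorem A.2.**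 If $(u_k)_{k\ge1}$ is a sequence of functions that are $\alpha$-harmonic in $\Omega$ and $u_k\to u$ uniformly on $\mathbb{R}^n$, then $u$ is $\alpha$-harmonic in $\Omega$. -/

import Mathlib

open Set Filter Topology MeasureTheory

noncomputable section

/-- The weighted space `𝓛_α(ℝⁿ)`: the (Lebesgue) measurable functions `u : ℝⁿ → ℝ` with
`∫ |u(x)| / (1 + |x|^(n+α)) dx < ∞`. -/
def MemWeightedL1 {n : ℕ} (α : ℝ) (u : EuclideanSpace ℝ (Fin n) → ℝ) : Prop :=
  AEStronglyMeasurable u volume ∧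
    Integrable (fun x => |u x| / (1 + ‖x‖ ^ ((n : ℝ) + α))) volume

/-- `u ∈ C^{k,β}_loc(Ω)` for an open set `Ω`: `u` is `k` times continuously differentiable in `Ω`
and its `k`-th derivative is Hölder continuous with exponent `β` near every point of `Ω`
(by compactness: on every compact subset of `Ω`). -/
def IsHolderLocOn {n : ℕ} (k : ℕ) (β : NNReal) (u : EuclideanSpace ℝ (Fin n) → ℝ)
    (Ω : Set (EuclideanSpace ℝ (Fin n))) : Prop :=
  ContDiffOn ℝ k u Ω ∧
    ∀ x ∈ Ω, ∃ C : NNReal, ∃ U ∈ 𝓝 x, HolderOnWith C β (iteratedFDeriv ℝ k u) U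

/-- `u ∈ C^{[α],{α}+ε}_loc(Ω)` for some (arbitrarily small) `ε > 0`, where `[α]` and `{α}` are the
integer and the fractional part of `α`; the exponent `β = {α} + ε` is smaller than `1`. -/
def IsHolderLocAbove {n : ℕ} (α : ℝ) (u : EuclideanSpace ℝ (Fin n) → ℝ)
    (Ω : Set (EuclideanSpace ℝ (Fin n))) : Prop :=
  ∃ β : NNReal, Int.fract α < (β : ℝ) ∧ (β : ℝ) < 1 ∧ IsHolderLocOn ⌊α⌋₊ β u Ω

/-- The usual normalizing constant of the fractional Laplacian `(-Δ)^{α/2}` on `ℝⁿ`,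
`α 2^(α-1) Γ((n+α)/2) / (π^(n/2) Γ(1-α/2))`, which is positive for `0 < α < 2`. -/
def fracLaplacianConst (n : ℕ) (α : ℝ) : ℝ :=
  α * 2 ^ (α - 1) * Real.Gamma (((n : ℝ) + α) / 2) /
    (Real.pi ^ ((n : ℝ) / 2) * Real.Gamma (1 - α / 2))

/-- The integrand `(u(x) - u(y)) / |x - y|^(n+α)` of the fractional Laplacian at `x`. -/
def fracLaplacianIntegrand {n : ℕ} (α : ℝ) (u : EuclideanSpace ℝ (Fin n) → ℝ)
    (x y : EuclideanSpace ℝ (Fin n)) : ℝ :=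
  (u x - u y) / ‖x - y‖ ^ ((n : ℝ) + α)

/-- `(-Δ)^{α/2} u(x)` exists as a principal value and equals `v`: for every `ε > 0` the integrand
is integrable over `|y - x| ≥ ε`, and
`C_{n,α} ∫_{|y-x| ≥ ε} (u(x) - u(y)) / |x - y|^(n+α) dy → v` as `ε → 0⁺`. -/
def HasFracLaplacianAt {n : ℕ} (α : ℝ) (u : EuclideanSpace ℝ (Fin n) → ℝ)
    (x : EuclideanSpace ℝ (Fin n)) (v : ℝ) : Prop :=
  (∀ ε : ℝ, 0 < ε →
    IntegrableOn (fracLaplacianIntegrand α u x) {y | ε ≤ ‖y - x‖} volume) ∧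
  Tendsto
    (fun ε : ℝ => fracLaplacianConst n α *
      ∫ y in {y | ε ≤ ‖y - x‖}, fracLaplacianIntegrand α u x y)
    (𝓝[>] 0) (𝓝 v)

/-- `u` is `α`-harmonic in `Ω`: `u ∈ C^{[α],{α}+ε}_loc(Ω) ∩ 𝓛_α(ℝⁿ)` for some `ε > 0`, and
`(-Δ)^{α/2} u = 0` pointwise in `Ω`. -/
structure IsAlphaHarmonicOn {n : ℕ} (α : ℝ) (u : EuclideanSpace ℝ (Fin n) → ℝ)
    (Ω : Set (EuclideanSpace ℝ (Fin n))) : Prop where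
  holder : IsHolderLocAbove α u Ω
  memWeightedL1 : MemWeightedL1 α u
  fracLaplacian_eq_zero : ∀ x ∈ Ω, HasFracLaplacianAt α u x 0

end

/-! The functions `u k` may be unbounded, but for large `k` the differences `w = u k - u N` are
bounded and α-harmonic in Ω. Everything rests on interior estimates for such `w` that are linear in
`sup |w|`. The limit is then recovered from `v = u N + lim (u k - u N)`.

The estimates come from an explicit reproducing kernel. Let φ be a smooth radially decreasing bump
on the unit ball and ψ its unnormalized fractional Laplacian. By symmetry of the operator, `∫ w(x+z)
ψ(τz) dz = 0` as soon as the ball of radius `1/τ` about `x` lies where `w` is harmonic. With `M(x) =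
∫₀¹ σ^(n-1) ψ(σx) dσ` one has `t^n M(tx) = ∫₀ᵗ τ^(n-1) ψ(τx) dτ`, so `∫ w(x+z) t^n M(tz) dz` does
not depend on `t ≥ 1/r`. As `t → ∞` it tends to `w(x) ∫ M`. Here M is integrable: ψ has integral
zero, so the radial integral up to `|x|` is minus its tail and M decays like `|x|^(-n-α)`. Also `∫ M
> 0`: a rearrangement argument shows that ψ has nonnegative integral over centred balls, hence `M ≥
0`, and `M(0) > 0` (`integral_meanKernel_pos`).

Thus `w` is locally a convolution with M (`IsBddHarmonicOn.integral_mul_meanKernel`). Iterated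
differences fall on φ, whose smoothness makes those of ψ and M small in L¹, and this gives
`exists_interior_estimate`.

In the limit, second differences of `u k - u N` are bounded by a fixed multiple of `|h|²` for small
`h`. Since `2 > α`, dominated convergence carries the equation over. First differences make `v - u
N` locally Lipschitz; when `α ≥ 1` they also make the gradients converge, and mixed second
differences make the limiting gradient of `v - u N` locally Lipschitz. Since the Hölder exponent of
`u N` is below 1, `v` inherits it. -/

/-- The iterated forward difference of `f` with the steps in the list `l`. -/
def iterDiff {E F : Type*} [AddCommGroup E] [AddCommGroup F] : List E → (E → F) → E → F
  | [], f => f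
  | h :: l, f => fun x => iterDiff l f (x + h) - iterDiff l f x

/-- The symmetric second difference `2 g(x) - g(x+h) - g(x-h)`. -/
def secondDiff {E : Type*} [AddCommGroup E] (g : E → ℝ) (x h : E) : ℝ :=
  2 * g x - g (x + h) - g (x - h)

/-- The kernel `|h|^{-(n+α)}` of the fractional Laplacian. -/
noncomputable def fracKernel {n : ℕ} (α : ℝ) (h : EuclideanSpace ℝ (Fin n)) : ℝ :=
  (‖h‖ ^ ((n : ℝ) + α))⁻¹

/-- The (non-normalized) fractional Laplacian written with symmetric second differences. -/
noncomputable def symmLaplacian {n : ℕ} (α : ℝ) (g : EuclideanSpace ℝ (Fin n) → ℝ)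
    (x : EuclideanSpace ℝ (Fin n)) : ℝ :=
  ∫ h, secondDiff g x h * fracKernel α h

/-! ### Iterated differences. -/

section IterDiff

theorem iterDiff_congr_shift {E F : Type*} [AddCommGroup E] [AddCommGroup F] (l : List E)
    (f : E → F) (a x : E) : iterDiff l (fun y => f (y + a)) x = iterDiff l f (x + a) := by
  induction l generalizing x with
  | nil => rfl
  | cons h l ih => simp only [iterDiff, ih]; rw [add_right_comm]

theorem continuous_iterDiff {E F : Type*} [NormedAddCommGroup E] [NormedAddCommGroup F]
    (l : List E) {f : E → F} (hf : Continuous f) : Continuous (iterDiff l f) := by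
  induction l with
  | nil => exact hf
  | cons h l ih => simp only [iterDiff]; fun_prop

/-- This lets a bound on (m+2)-fold differences control the second differences of m-fold ones. -/
theorem secondDiff_iterDiff {E : Type*} [AddCommGroup E] (l : List E) (g : E → ℝ) (x h : E) :
    secondDiff (iterDiff l g) x h = -iterDiff (h :: h :: l) g (x - h) := by
  simp only [secondDiff, iterDiff, sub_add_cancel]
  ring

theorem iterDiff_secondDiff {E : Type*} [AddCommGroup E] (l : List E) (g : E → ℝ) (x h : E) :
    iterDiff l (fun y => secondDiff g y h) x = secondDiff (iterDiff l g) x h := by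
  induction l generalizing x with
  | nil => rfl
  | cons k l ih =>
    simp only [iterDiff, ih]
    simp only [secondDiff]
    rw [add_right_comm x k h, add_sub_right_comm x k h]
    ring

theorem iterDiff_mul_const {E : Type*} [AddCommGroup E] (l : List E) (g : E → ℝ) (c : ℝ) (x : E) :
    iterDiff l (fun y => g y * c) x = iterDiff l g x * c := by
  induction l generalizing x with
  | nil => rfl
  | cons k l ih => simp only [iterDiff, ih, sub_mul]

theorem iterDiff_const_mul {E : Type*} [AddCommGroup E] (l : List E) (g : E → ℝ) (c : ℝ) (x : E) :
    iterDiff l (fun y => c * g y) x = c * iterDiff l g x := by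
  induction l generalizing x with
  | nil => rfl
  | cons k l ih => simp only [iterDiff, ih, mul_sub]

theorem iterDiff_comp_smul {E : Type*} [AddCommGroup E] [Module ℝ E] (l : List E) (g : E → ℝ)
    (c : ℝ) (x : E) :
    iterDiff l (fun y => g (c • y)) x = iterDiff (l.map (c • ·)) g (c • x) := by
  induction l generalizing x with
  | nil => rfl
  | cons k l ih => simp only [iterDiff, ih, List.map_cons, smul_add]

theorem iterDiff_integral {E X : Type*} [AddCommGroup E] [MeasurableSpace X] {μ : Measure X}
    (l : List E) (f : E → X → ℝ) (hf : ∀ x, Integrable (f x) μ) (x : E) :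
    iterDiff l (fun y => ∫ z, f y z ∂μ) x = ∫ z, iterDiff l (fun y => f y z) x ∂μ ∧
      Integrable (fun z => iterDiff l (fun y => f y z) x) μ := by
  induction l generalizing x with
  | nil => exact ⟨rfl, hf x⟩
  | cons k l ih =>
    simp only [iterDiff]
    exact ⟨by rw [(ih _).1, (ih _).1, integral_sub (ih _).2 (ih _).2], (ih _).2.sub (ih _).2⟩

theorem iterDiff_eq_zero_of_norm_gt {E : Type*} [NormedAddCommGroup E] {f : E → ℝ} {R : ℝ}
    (hf : ∀ x, R < ‖x‖ → f x = 0) (l : List E) (hl : ∀ h ∈ l, ‖h‖ ≤ 1) (x : E)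
    (hx : R + l.length < ‖x‖) : iterDiff l f x = 0 := by
  induction l generalizing x with
  | nil => exact hf x (by simpa using hx)
  | cons k l ih =>
    have hk : ‖k‖ ≤ 1 := hl k (by simp)
    simp only [List.length_cons, Nat.cast_add, Nat.cast_one] at hx
    have h1 : ‖x‖ - ‖k‖ ≤ ‖x + k‖ := by
      have := norm_sub_norm_le x (-k); rwa [norm_neg, sub_neg_eq_add] at this
    have h2 := fun h hh => hl h (List.mem_cons_of_mem k hh)
    simp only [iterDiff]
    rw [ih h2 _ (by linarith), ih h2 _ (by linarith), sub_self]

theorem hasFDerivAt_iterDiff {E F : Type*} [NormedAddCommGroup E] [NormedSpace ℝ E]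
    [NormedAddCommGroup F] [NormedSpace ℝ F] (l : List E) {f : E → F} (hf : Differentiable ℝ f)
    (x : E) : HasFDerivAt (iterDiff l f) (iterDiff l (fderiv ℝ f) x) x := by
  induction l generalizing x with
  | nil => exact (hf x).hasFDerivAt
  | cons k l ih =>
    simp only [iterDiff]
    exact ((hasFDerivAt_comp_add_right k).2 (ih (x + k))).sub (ih x)

/-- Iterated differences of a smooth compactly supported function are bounded by the product of
the lengths of the steps. -/
theorem exists_norm_iterDiff_le {E : Type} [NormedAddCommGroup E] [NormedSpace ℝ E] (m : ℕ) :
    ∀ {F : Type} [NormedAddCommGroup F] [NormedSpace ℝ F] (f : E → F),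
      ContDiff ℝ (⊤ : ℕ∞) f → HasCompactSupport f →
      ∃ C : ℝ, 0 ≤ C ∧ ∀ l : List E, l.length = m → ∀ x,
        ‖iterDiff l f x‖ ≤ C * (l.map norm).prod := by
  -- The target `F` stays quantified: the inductive step passes from `f` to its derivative, with
  -- values in `E →L[ℝ] F`, and spends the first step of the list by the mean value inequality.
  induction m with
  | zero =>
    intro F _ _ f hf hc
    obtain ⟨C, hC⟩ := hc.exists_bound_of_continuous hf.continuous
    refine ⟨max C 0, le_max_right _ _, fun l hl x => ?_⟩
    rw [List.length_eq_zero_iff.mp hl]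
    simpa [iterDiff] using Or.inl (hC x)
  | succ m ih =>
    intro F _ _ f hf hc
    obtain ⟨C, hC0, hC⟩ := ih (fderiv ℝ f) (hf.fderiv_right (by simp)) (hc.fderiv ℝ)
    refine ⟨C, hC0, fun l hl x => ?_⟩
    match l, hl with
    | k :: l, hl =>
      simp only [List.length_cons, add_left_inj] at hl
      have hd : Differentiable ℝ f := hf.differentiable (by simp)
      have := convex_univ.norm_image_sub_le_of_norm_hasFDerivWithin_le (𝕜 := ℝ)
        (fun y _ => (hasFDerivAt_iterDiff l hd y).hasFDerivWithinAt) (fun y _ => hC l hl y)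
        (mem_univ x) (mem_univ (x + k))
      simp only [iterDiff, List.map_cons, List.prod_cons]
      calc _ ≤ C * (l.map norm).prod * ‖x + k - x‖ := this
        _ = _ := by rw [add_sub_cancel_left]; ring

end IterDiff

/-! ### Integrability of the singular kernel. -/

section Kernel

variable {n : ℕ} {α s : ℝ}

theorem fracKernel_nonneg (h : EuclideanSpace ℝ (Fin n)) : 0 ≤ fracKernel α h := by
  unfold fracKernel; positivity

theorem fracKernel_neg (h : EuclideanSpace ℝ (Fin n)) : fracKernel α (-h) = fracKernel α h := by
  simp [fracKernel]

theorem measurable_fracKernel : Measurable (fracKernel (n := n) α) := by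
  unfold fracKernel; fun_prop

theorem fracKernel_smul {t : ℝ} (ht : 0 ≤ t) (h : EuclideanSpace ℝ (Fin n)) :
    fracKernel α (t • h) = (t ^ ((n : ℝ) + α))⁻¹ * fracKernel α h := by
  unfold fracKernel
  rw [norm_smul, Real.norm_of_nonneg ht, Real.mul_rpow ht (norm_nonneg _), mul_inv]

/-- In polar coordinates the integrand is `y^(s-α-1)` near 0, integrable as `s > α`, and `y^(-α-1)`
near infinity, integrable as `α > 0`. -/
theorem integrable_min_mul_fracKernel (hn : 1 ≤ n) (hα : 0 < α) (hs : α < s) :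
    Integrable (fun h : EuclideanSpace ℝ (Fin n) => min 1 (‖h‖ ^ s) * fracKernel α h) := by
  have : Nontrivial (EuclideanSpace ℝ (Fin n)) := by
    have : Nonempty (Fin n) := ⟨⟨0, hn⟩⟩
    infer_instance
  unfold fracKernel
  refine (integrable_fun_norm_addHaar (volume : Measure (EuclideanSpace ℝ (Fin n)))
    (f := fun y => min 1 (y ^ s) * (y ^ ((n : ℝ) + α))⁻¹)).2 ?_
  have hpow : ∀ y : ℝ, 0 < y → y ^ (n - 1) * (y ^ ((n : ℝ) + α))⁻¹ = y ^ (-α - 1) := by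
    intro y hy
    rw [← Real.rpow_natCast, ← Real.rpow_neg hy.le, ← Real.rpow_add hy]
    congr 1
    push_cast [hn]; ring
  simp only [finrank_euclideanSpace, Fintype.card_fin, smul_eq_mul]
  rw [← Ioc_union_Ioi_eq_Ioi zero_le_one]
  refine IntegrableOn.union ?_ ?_
  · have h1 : IntegrableOn (fun y : ℝ => y ^ (s - α - 1)) (Ioc 0 1) := by
      rw [← intervalIntegrable_iff_integrableOn_Ioc_of_le zero_le_one]
      exact intervalIntegral.intervalIntegrable_rpow' (by linarith)
    refine h1.congr_fun (fun y hy => ?_) measurableSet_Ioc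
    rw [min_eq_right (Real.rpow_le_one hy.1.le hy.2 (by linarith)), mul_left_comm, hpow y hy.1,
      ← Real.rpow_add hy.1]
    ring_nf
  · have h1 : IntegrableOn (fun y : ℝ => y ^ (-α - 1)) (Ioi 1) :=
      integrableOn_Ioi_rpow_of_lt (by linarith) one_pos
    refine h1.congr_fun (fun y hy => ?_) measurableSet_Ioi
    have hy : 1 < y := hy
    simp only
    rw [min_eq_left (Real.one_le_rpow hy.le (by linarith)), one_mul, hpow y (by linarith)]

theorem measurableSet_le_norm {E : Type*} [NormedAddCommGroup E] [MeasurableSpace E]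
    [BorelSpace E] (ε : ℝ) : MeasurableSet {h : E | ε ≤ ‖h‖} :=
  (isClosed_le continuous_const continuous_norm).measurableSet

theorem integrableOn_fracKernel (hn : 1 ≤ n) (hα : 0 < α) {ε : ℝ} (hε : 0 < ε) :
    IntegrableOn (fracKernel (n := n) α) {h | ε ≤ ‖h‖} := by
  have h1 := integrable_min_mul_fracKernel (n := n) (s := α + 1) hn hα (by linarith)
  have hpos : 0 < min 1 (ε ^ (α + 1)) := by positivity
  refine Integrable.mono' ((h1.const_mul (min 1 (ε ^ (α + 1)))⁻¹).integrableOn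
    (s := {h | ε ≤ ‖h‖})) measurable_fracKernel.aestronglyMeasurable.restrict ?_
  refine (ae_restrict_iff' (measurableSet_le_norm ε)).2 (ae_of_all _ fun h hh => ?_)
  rw [Real.norm_of_nonneg (fracKernel_nonneg h), ← mul_assoc]
  refine le_mul_of_one_le_left (fracKernel_nonneg h) ?_
  rw [inv_mul_eq_div, one_le_div hpos]
  exact min_le_min le_rfl (Real.rpow_le_rpow hε.le hh (by linarith))

theorem tendsto_setIntegral_le_norm (hn : 1 ≤ n) {F : EuclideanSpace ℝ (Fin n) → ℝ}
    (hF : Integrable F) :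
    Tendsto (fun ε : ℝ => ∫ h in {h | ε ≤ ‖h‖}, F h) (𝓝[>] 0) (𝓝 (∫ h, F h)) := by
  have : Nontrivial (EuclideanSpace ℝ (Fin n)) := by
    have : Nonempty (Fin n) := ⟨⟨0, hn⟩⟩
    infer_instance
  simp_rw [← integral_indicator (measurableSet_le_norm _)]
  refine tendsto_integral_filter_of_dominated_convergence (fun h => ‖F h‖)
    (Eventually.of_forall fun ε => hF.1.indicator (measurableSet_le_norm ε))
    (Eventually.of_forall fun ε => ae_of_all _ fun h => norm_indicator_le_norm_self _ _)
    hF.norm ?_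
  have : ∀ᵐ h : EuclideanSpace ℝ (Fin n), h ≠ 0 := by simp [ae_iff]
  filter_upwards [this] with h hh
  refine tendsto_const_nhds.congr' ?_
  have : Iio ‖h‖ ∈ 𝓝[>] (0 : ℝ) := mem_nhdsWithin_of_mem_nhds (Iio_mem_nhds (norm_pos_iff.2 hh))
  filter_upwards [this] with ε hε
  rw [indicator_of_mem]
  exact (mem_Iio.1 hε).le

end Kernel

/-! ### The symmetrized fractional Laplacian: L¹ bounds and symmetry. -/

section SymmLaplacian

variable {n : ℕ} {α : ℝ}

theorem integral_two_mul_sub_sub {X : Type*} [MeasurableSpace X] {μ : Measure X} {a b c : X → ℝ}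
    (ha : Integrable a μ) (hb : Integrable b μ) (hc : Integrable c μ) :
    ∫ x, (2 * a x - b x - c x) ∂μ = 2 * ∫ x, a x ∂μ - ∫ x, b x ∂μ - ∫ x, c x ∂μ := by
  rw [integral_sub (f := fun x => 2 * a x - b x) ((ha.const_mul 2).sub hb) hc,
    integral_sub (ha.const_mul 2) hb, integral_const_mul]

theorem aestronglyMeasurable_secondDiff {w : EuclideanSpace ℝ (Fin n) → ℝ}
    (hw : AEStronglyMeasurable w volume) (x : EuclideanSpace ℝ (Fin n)) :
    AEStronglyMeasurable (fun h => secondDiff w x h) volume :=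
  (aestronglyMeasurable_const.sub
    (hw.comp_measurePreserving (measurePreserving_add_left volume x))).sub
    (hw.comp_measurePreserving (Measure.measurePreserving_sub_left volume x))

theorem integrable_secondDiff_mul_fracKernel (hn : 1 ≤ n) (hα : 0 < α)
    {w : EuclideanSpace ℝ (Fin n) → ℝ} (hw : AEStronglyMeasurable w volume)
    {x : EuclideanSpace ℝ (Fin n)} {s C : ℝ} (hs : α < s)
    (hC : ∀ h, |secondDiff w x h| ≤ C * min 1 (‖h‖ ^ s)) :
    Integrable (fun h => secondDiff w x h * fracKernel α h) := by
  refine ((integrable_min_mul_fracKernel hn hα hs).const_mul C).mono'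
    ((aestronglyMeasurable_secondDiff hw x).mul measurable_fracKernel.aestronglyMeasurable)
    (ae_of_all _ fun h => ?_)
  rw [norm_mul, Real.norm_eq_abs, Real.norm_of_nonneg (fracKernel_nonneg h), ← mul_assoc]
  exact mul_le_mul_of_nonneg_right (hC h) (fracKernel_nonneg h)

/-- A continuous function supported in the ball of radius `R` which is bounded by `A` together with
its second difference quotients. -/
structure IsTestBound (R A : ℝ) (g : EuclideanSpace ℝ (Fin n) → ℝ) : Prop where
  continuous : Continuous g
  eq_zero : ∀ x, R < ‖x‖ → g x = 0
  abs_le : ∀ x, |g x| ≤ A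
  abs_secondDiff_le : ∀ x h, |secondDiff g x h| ≤ A * ‖h‖ ^ (2 : ℝ)

namespace IsTestBound

variable {R A : ℝ} {g : EuclideanSpace ℝ (Fin n) → ℝ}

theorem bound_nonneg (hg : IsTestBound R A g) : 0 ≤ A := (abs_nonneg _).trans (hg.abs_le 0)

theorem hasCompactSupport (hg : IsTestBound R A g) : HasCompactSupport g :=
  HasCompactSupport.intro (isCompact_closedBall 0 R) fun x hx =>
    hg.eq_zero x (by simpa using hx)

theorem integrable (hg : IsTestBound R A g) : Integrable g :=
  hg.continuous.integrable_of_hasCompactSupport hg.hasCompactSupport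

theorem abs_secondDiff_le_min (hg : IsTestBound R A g) (x h : EuclideanSpace ℝ (Fin n)) :
    |secondDiff g x h| ≤ 4 * A * min 1 (‖h‖ ^ (2 : ℝ)) := by
  have hA := hg.bound_nonneg
  rcases min_choice 1 (‖h‖ ^ (2 : ℝ)) with h1 | h1
  · rw [h1]
    have a := _root_.abs_le.1 (hg.abs_le x)
    have b := _root_.abs_le.1 (hg.abs_le (x + h))
    have c := _root_.abs_le.1 (hg.abs_le (x - h))
    unfold secondDiff
    exact _root_.abs_le.2 ⟨by linarith, by linarith⟩
  · rw [h1]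
    have h2 : 0 ≤ A * ‖h‖ ^ (2 : ℝ) := by positivity
    linarith [hg.abs_secondDiff_le x h]

theorem integrable_secondDiff_left (hg : IsTestBound R A g) (h : EuclideanSpace ℝ (Fin n)) :
    Integrable (fun x => secondDiff g x h) :=
  ((hg.integrable.const_mul 2).sub (hg.integrable.comp_add_right h)).sub
    (hg.integrable.comp_sub_right h)

theorem integral_abs_le (hg : IsTestBound R A g) :
    ∫ x, |g x| ≤ A * volume.real (Metric.closedBall (0 : EuclideanSpace ℝ (Fin n)) (R + 1)) := by
  have hA := hg.bound_nonneg
  have hi : Integrable ((Metric.closedBall (0 : EuclideanSpace ℝ (Fin n)) (R + 1)).indicator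
      fun _ => A) :=
    (integrable_indicator_iff Metric.isClosed_closedBall.measurableSet).2
      (integrableOn_const (measure_closedBall_lt_top).ne)
  calc ∫ x, |g x| ≤ ∫ x, (Metric.closedBall (0 : EuclideanSpace ℝ (Fin n)) (R + 1)).indicator
        (fun _ => A) x := by
        refine integral_mono hg.integrable.abs hi fun x => ?_
        by_cases hx : ‖x‖ ≤ R
        · rw [indicator_of_mem (by simpa using hx.trans (by linarith))]
          exact hg.abs_le x
        · simp only [hg.eq_zero x (not_le.1 hx), abs_zero]
          exact indicator_nonneg (fun _ _ => hA) _
    _ = _ := by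
      rw [integral_indicator_const _ Metric.isClosed_closedBall.measurableSet, smul_eq_mul,
        mul_comm]

/-- For `‖h‖ ≤ 1` the second difference lives in the ball of radius `R + 1`, where the quadratic
bound applies. For larger `h` the support moves away, but translation invariance still gives `4 ∫
|g|`. -/
theorem integral_abs_secondDiff_le (hg : IsTestBound R A g) (h : EuclideanSpace ℝ (Fin n)) :
    ∫ x, |secondDiff g x h| ≤
      4 * A * volume.real (Metric.closedBall (0 : EuclideanSpace ℝ (Fin n)) (R + 1)) *
        min 1 (‖h‖ ^ (2 : ℝ)) := by
  have hA := hg.bound_nonneg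
  set V := volume.real (Metric.closedBall (0 : EuclideanSpace ℝ (Fin n)) (R + 1)) with hV
  have hV0 : 0 ≤ V := measureReal_nonneg
  by_cases h1 : ‖h‖ ≤ 1
  · rw [min_eq_right (Real.rpow_le_one (norm_nonneg _) h1 (by norm_num))]
    have hi : Integrable ((Metric.closedBall (0 : EuclideanSpace ℝ (Fin n)) (R + 1)).indicator
        fun _ => A * ‖h‖ ^ (2 : ℝ)) :=
      (integrable_indicator_iff Metric.isClosed_closedBall.measurableSet).2
        (integrableOn_const (measure_closedBall_lt_top).ne)
    calc ∫ x, |secondDiff g x h| ≤ ∫ x, (Metric.closedBall (0 : EuclideanSpace ℝ (Fin n))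
          (R + 1)).indicator (fun _ => A * ‖h‖ ^ (2 : ℝ)) x := by
          refine integral_mono (hg.integrable_secondDiff_left h).abs hi fun x => ?_
          by_cases hx : ‖x‖ ≤ R + 1
          · rw [indicator_of_mem (by simpa using hx)]
            exact hg.abs_secondDiff_le x h
          · rw [indicator_of_notMem (by simpa using hx)]
            push Not at hx
            have a1 := norm_sub_norm_le x h
            have a2 : ‖x‖ - ‖h‖ ≤ ‖x + h‖ := by
              have := norm_sub_norm_le x (-h); rwa [norm_neg, sub_neg_eq_add] at this
            simp [secondDiff, hg.eq_zero x (by linarith), hg.eq_zero (x + h) (by linarith),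
              hg.eq_zero (x - h) (by linarith)]
      _ = V * (A * ‖h‖ ^ (2 : ℝ)) := by
        rw [integral_indicator_const _ Metric.isClosed_closedBall.measurableSet, smul_eq_mul]
      _ ≤ _ := by
        have : 0 ≤ V * (A * ‖h‖ ^ (2 : ℝ)) := by positivity
        linarith
  · rw [min_eq_left (Real.one_le_rpow (not_le.1 h1).le (by norm_num)), mul_one]
    have i0 := hg.integrable.abs
    have i1 := i0.comp_add_right h
    have i2 := i0.comp_sub_right h
    calc ∫ x, |secondDiff g x h| ≤ ∫ x, (2 * |g x| + |g (x + h)| + |g (x - h)|) := by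
          refine integral_mono (hg.integrable_secondDiff_left h).abs
            (((i0.const_mul 2).add i1).add i2) fun x => ?_
          simp only [secondDiff]
          calc _ ≤ |2 * g x| + |g (x + h)| + |g (x - h)| :=
                (abs_sub _ _).trans (add_le_add_left (abs_sub _ _) _)
            _ = _ := by rw [abs_mul, abs_two]
      _ = 4 * ∫ x, |g x| := by
        rw [integral_add (f := fun x => 2 * |g x| + |g (x + h)|) ((i0.const_mul 2).add i1) i2,
          integral_add (i0.const_mul 2) i1,
          integral_const_mul, integral_add_right_eq_self (fun x => |g x|),
          integral_sub_right_eq_self (fun x => |g x|)]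
        ring
      _ ≤ 4 * (A * V) := by linarith [hg.integral_abs_le]
      _ = _ := by ring

theorem aestronglyMeasurable_prod (hg : IsTestBound R A g) :
    AEStronglyMeasurable (fun p : EuclideanSpace ℝ (Fin n) × EuclideanSpace ℝ (Fin n) =>
      secondDiff g p.1 p.2 * fracKernel α p.2) (volume.prod volume) := by
  have h1 : Continuous (fun p : EuclideanSpace ℝ (Fin n) × EuclideanSpace ℝ (Fin n) =>
      secondDiff g p.1 p.2) := by
    have := hg.continuous
    unfold secondDiff; fun_prop
  exact (h1.measurable.mul (measurable_fracKernel.comp measurable_snd)).aestronglyMeasurable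

theorem integral_norm_mul_fracKernel_le (hg : IsTestBound R A g)
    (h : EuclideanSpace ℝ (Fin n)) :
    ∫ x, ‖secondDiff g x h * fracKernel α h‖ ≤
      4 * A * volume.real (Metric.closedBall (0 : EuclideanSpace ℝ (Fin n)) (R + 1)) *
        (min 1 (‖h‖ ^ (2 : ℝ)) * fracKernel α h) := by
  simp only [norm_mul, Real.norm_of_nonneg (fracKernel_nonneg h), Real.norm_eq_abs]
  rw [integral_mul_const, ← mul_assoc]
  exact mul_le_mul_of_nonneg_right (hg.integral_abs_secondDiff_le h) (fracKernel_nonneg h)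

/-- Integrating in `x` first leaves a multiple of `min 1 (‖h‖²)` times the kernel, integrable
because `α < 2`. -/
theorem integrable_prod (hn : 1 ≤ n) (hα : 0 < α) (hα₂ : α < 2) (hg : IsTestBound R A g) :
    Integrable (fun p : EuclideanSpace ℝ (Fin n) × EuclideanSpace ℝ (Fin n) =>
      secondDiff g p.1 p.2 * fracKernel α p.2) (volume.prod volume) := by
  refine (integrable_prod_iff' hg.aestronglyMeasurable_prod).2
    ⟨ae_of_all _ fun h => (hg.integrable_secondDiff_left h).mul_const (fracKernel α h), ?_⟩
  refine ((integrable_min_mul_fracKernel hn hα hα₂).const_mul (4 * A * volume.real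
    (Metric.closedBall (0 : EuclideanSpace ℝ (Fin n)) (R + 1)))).mono'
    (hg.aestronglyMeasurable_prod.norm.prod_swap.integral_prod_right')
    (ae_of_all _ fun h => ?_)
  rw [Real.norm_of_nonneg (integral_nonneg fun _ => norm_nonneg _)]
  exact hg.integral_norm_mul_fracKernel_le h

theorem integrable_symmLaplacian (hn : 1 ≤ n) (hα : 0 < α) (hα₂ : α < 2)
    (hg : IsTestBound R A g) : Integrable (symmLaplacian α g) :=
  (hg.integrable_prod hn hα hα₂).integral_prod_left

/-- Linearity in `A` is what matters: for iterated differences of the bump, `A` is a multiple of the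
product of the step lengths. -/
theorem integral_abs_symmLaplacian_le (hn : 1 ≤ n) (hα : 0 < α) (hα₂ : α < 2)
    (hg : IsTestBound R A g) :
    ∫ x, |symmLaplacian α g x| ≤
      4 * volume.real (Metric.closedBall (0 : EuclideanSpace ℝ (Fin n)) (R + 1)) *
        (∫ h : EuclideanSpace ℝ (Fin n), min 1 (‖h‖ ^ (2 : ℝ)) * fracKernel α h) * A := by
  have hi := hg.integrable_prod hn hα hα₂
  calc ∫ x, |symmLaplacian α g x| ≤ ∫ x, ∫ h, ‖secondDiff g x h * fracKernel α h‖ := by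
        refine integral_mono (hg.integrable_symmLaplacian hn hα hα₂).abs hi.norm.integral_prod_left
          fun x => ?_
        exact norm_integral_le_integral_norm (fun h => secondDiff g x h * fracKernel α h)
    _ = ∫ h, ∫ x, ‖secondDiff g x h * fracKernel α h‖ := integral_integral_swap hi.norm
    _ ≤ ∫ h : EuclideanSpace ℝ (Fin n), 4 * A *
        volume.real (Metric.closedBall (0 : EuclideanSpace ℝ (Fin n)) (R + 1)) *
        (min 1 (‖h‖ ^ (2 : ℝ)) * fracKernel α h) :=
      integral_mono hi.norm.integral_prod_right
        ((integrable_min_mul_fracKernel hn hα hα₂).const_mul _)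
        fun h => hg.integral_norm_mul_fracKernel_le h
    _ = _ := by rw [integral_const_mul]; ring

theorem integral_mul_symmLaplacian (hn : 1 ≤ n) (hα : 0 < α) (hα₂ : α < 2)
    (hg : IsTestBound R A g) {w : EuclideanSpace ℝ (Fin n) → ℝ}
    (hw : AEStronglyMeasurable w volume) {B : ℝ} (hB : ∀ x, |w x| ≤ B) :
    ∫ x, w x * symmLaplacian α g x =
      ∫ h, (∫ x, w x * secondDiff g x h) * fracKernel α h := by
  have hi : Integrable (fun p : EuclideanSpace ℝ (Fin n) × EuclideanSpace ℝ (Fin n) =>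
      w p.1 * (secondDiff g p.1 p.2 * fracKernel α p.2)) (volume.prod volume) :=
    (hg.integrable_prod hn hα hα₂).bdd_mul (c := B) hw.comp_fst (ae_of_all _ fun p => hB p.1)
  calc ∫ x, w x * symmLaplacian α g x
      = ∫ x, ∫ h, w x * (secondDiff g x h * fracKernel α h) := by
        simp only [symmLaplacian, integral_const_mul]
    _ = ∫ h, ∫ x, w x * (secondDiff g x h * fracKernel α h) := integral_integral_swap hi
    _ = _ := by simp only [← mul_assoc, integral_mul_const]

theorem integral_symmLaplacian (hn : 1 ≤ n) (hα : 0 < α) (hα₂ : α < 2)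
    (hg : IsTestBound R A g) : ∫ x, symmLaplacian α g x = 0 := by
  -- Fubini against the constant function 1: every second difference has integral zero.
  have := hg.integral_mul_symmLaplacian hn hα hα₂ (w := fun _ => 1) aestronglyMeasurable_const
    (B := 1) (by simp)
  simp only [one_mul] at this
  rw [this]
  refine integral_eq_zero_of_ae (ae_of_all _ fun h => ?_)
  have i0 := hg.integrable
  have : ∫ x, secondDiff g x h = 0 := by
    simp only [secondDiff]
    rw [integral_two_mul_sub_sub i0 (i0.comp_add_right h) (i0.comp_sub_right h),
      integral_add_right_eq_self, integral_sub_right_eq_self]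
    ring
  simp [this]

theorem integrable_mul_fracKernel (hn : 1 ≤ n) (hα : 0 < α) (hα₂ : α < 2)
    (hg : IsTestBound R A g) (x : EuclideanSpace ℝ (Fin n)) :
    Integrable (fun h => secondDiff g x h * fracKernel α h) :=
  integrable_secondDiff_mul_fracKernel hn hα hg.continuous.aestronglyMeasurable hα₂
    (hg.abs_secondDiff_le_min x)

theorem continuous_symmLaplacian (hn : 1 ≤ n) (hα : 0 < α) (hα₂ : α < 2)
    (hg : IsTestBound R A g) : Continuous (symmLaplacian α g) := by
  refine continuous_of_dominated
    (fun x => (hg.integrable_mul_fracKernel hn hα hα₂ x).1) (fun x => ae_of_all _ fun h => ?_)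
    ((integrable_min_mul_fracKernel hn hα hα₂).const_mul (4 * A)) (ae_of_all _ fun h => ?_)
  · rw [norm_mul, Real.norm_eq_abs, Real.norm_of_nonneg (fracKernel_nonneg h), ← mul_assoc]
    exact mul_le_mul_of_nonneg_right (hg.abs_secondDiff_le_min x h) (fracKernel_nonneg h)
  · have := hg.continuous
    unfold secondDiff; fun_prop

/-- The fractional Laplacian is symmetric: a bounded function whose fractional Laplacian vanishes
on the support of `g` is orthogonal to the fractional Laplacian of `g`. -/
theorem integral_mul_symmLaplacian_eq_zero (hn : 1 ≤ n) (hα : 0 < α) (hα₂ : α < 2)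
    (hg : IsTestBound R A g) {w : EuclideanSpace ℝ (Fin n) → ℝ}
    (hw : AEStronglyMeasurable w volume) {B : ℝ} (hB : ∀ x, |w x| ≤ B) {s C : ℝ} (hs : α < s)
    (hC : ∀ x, ‖x‖ ≤ R → ∀ h, |secondDiff w x h| ≤ C * min 1 (‖h‖ ^ s))
    (hL : ∀ x, ‖x‖ ≤ R → symmLaplacian α w x = 0) :
    ∫ x, w x * symmLaplacian α g x = 0 := by
  rw [hg.integral_mul_symmLaplacian hn hα hα₂ hw hB]
  have i0 := hg.integrable
  have hwg : ∀ k, Integrable (fun x => w x * g (x + k)) := fun k =>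
    (i0.comp_add_right k).bdd_mul hw (ae_of_all _ hB)
  have hwg' : ∀ k, Integrable (fun x => g x * w (x + k)) := fun k => by
    refine i0.mul_bdd (c := B) (hw.comp_measurePreserving (measurePreserving_add_right volume k))
      (ae_of_all _ fun x => hB _)
  -- Discrete integration by parts: translation invariance moves each shift from `g` to `w` with the
  -- opposite sign, and the second difference is even in the step.
  have key : ∀ h, ∫ x, w x * secondDiff g x h = ∫ x, g x * secondDiff w x h := by
    intro h
    have e : ∀ k, ∫ x, w x * g (x + k) = ∫ x, g x * w (x + -k) := fun k => by
      rw [← integral_add_right_eq_self (fun x => w x * g (x + k)) (-k)]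
      simp only [neg_add_cancel_right, mul_comm]
    have a1 : ∀ x, w x * secondDiff g x h =
        2 * (w x * g (x + 0)) - w x * g (x + h) - w x * g (x + -h) := fun x => by
      rw [secondDiff, add_zero, ← sub_eq_add_neg]; ring
    have a2 : ∀ x, g x * secondDiff w x h =
        2 * (g x * w (x + -0)) - g x * w (x + -h) - g x * w (x + - -h) := fun x => by
      rw [secondDiff, neg_zero, add_zero, neg_neg, ← sub_eq_add_neg]; ring
    simp only [a1, a2]
    rw [integral_two_mul_sub_sub (hwg 0) (hwg h) (hwg (-h)),
      integral_two_mul_sub_sub (hwg' (-0)) (hwg' (-h)) (hwg' (- -h)), e, e, e]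
  have hmeas : AEStronglyMeasurable
      (fun p : EuclideanSpace ℝ (Fin n) × EuclideanSpace ℝ (Fin n) =>
        g p.1 * (secondDiff w p.1 p.2 * fracKernel α p.2)) (volume.prod volume) := by
    have h1 : AEStronglyMeasurable
        (fun p : EuclideanSpace ℝ (Fin n) × EuclideanSpace ℝ (Fin n) => w (p.1 + p.2))
        (volume.prod volume) :=
      hw.comp_quasiMeasurePreserving (quasiMeasurePreserving_add volume volume)
    have h2 : AEStronglyMeasurable
        (fun p : EuclideanSpace ℝ (Fin n) × EuclideanSpace ℝ (Fin n) => w (p.1 - p.2))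
        (volume.prod volume) :=
      hw.comp_quasiMeasurePreserving
        (quasiMeasurePreserving_sub_of_right_invariant volume volume)
    exact (hg.continuous.comp continuous_fst).aestronglyMeasurable.mul
      ((((hw.comp_fst.const_mul 2).sub h1).sub h2).mul
        (measurable_fracKernel.comp measurable_snd).aestronglyMeasurable)
  have hi : Integrable (fun p : EuclideanSpace ℝ (Fin n) × EuclideanSpace ℝ (Fin n) =>
      g p.1 * (secondDiff w p.1 p.2 * fracKernel α p.2)) (volume.prod volume) := by
    -- Second differences of `w` are controlled only for `‖x‖ ≤ R`; elsewhere the factor `g x`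
    -- vanishes.
    refine (i0.norm.mul_prod
      ((integrable_min_mul_fracKernel hn hα hs).const_mul C)).mono' hmeas
      (ae_of_all _ fun p => ?_)
    rw [norm_mul]
    by_cases hp : ‖p.1‖ ≤ R
    · refine mul_le_mul_of_nonneg_left ?_ (norm_nonneg _)
      rw [norm_mul, Real.norm_eq_abs, Real.norm_of_nonneg (fracKernel_nonneg _), ← mul_assoc]
      exact mul_le_mul_of_nonneg_right (hC _ hp _) (fracKernel_nonneg _)
    · simp [hg.eq_zero p.1 (not_le.1 hp)]
  simp only [key, ← integral_mul_const, mul_assoc]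
  rw [← integral_integral_swap hi]
  refine integral_eq_zero_of_ae (ae_of_all _ fun x => ?_)
  simp only [integral_const_mul, Pi.zero_apply]
  by_cases hp : ‖x‖ ≤ R
  · exact mul_eq_zero_of_right _ (hL x hp)
  · rw [hg.eq_zero x (not_le.1 hp), zero_mul]

end IsTestBound

/-- The kernel is homogeneous, so an affine dilation multiplies the integral by a power of `t` and
preserves its vanishing. -/
theorem symmLaplacian_comp_add_smul (w : EuclideanSpace ℝ (Fin n) → ℝ) {t : ℝ} (ht : 0 < t)
    (a x : EuclideanSpace ℝ (Fin n)) (h0 : symmLaplacian α w (a + t • x) = 0) :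
    symmLaplacian α (fun z => w (a + t • z)) x = 0 := by
  have e : ∀ h, secondDiff (fun z => w (a + t • z)) x h * fracKernel α h =
      t ^ ((n : ℝ) + α) *
        (fun h => secondDiff w (a + t • x) h * fracKernel α h) (t • h) := by
    intro h
    have : 0 < t ^ ((n : ℝ) + α) := by positivity
    simp only [secondDiff, fracKernel_smul ht.le, smul_add, smul_sub, add_assoc, add_sub_assoc]
    field_simp
  unfold symmLaplacian at h0 ⊢
  rw [integral_congr_ae (ae_of_all _ e), integral_const_mul, Measure.integral_comp_smul volume
    (fun h => secondDiff w (a + t • x) h * fracKernel α h), h0]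
  simp

end SymmLaplacian

/-! ### The bump function and its fractional Laplacian ψ. -/

/-- A smooth radially decreasing function supported in the closed unit ball. -/
noncomputable def radialBump {n : ℕ} (x : EuclideanSpace ℝ (Fin n)) : ℝ :=
  Real.smoothTransition (1 - ‖x‖ ^ 2)

section RadialBump

variable {n : ℕ} {α : ℝ}

theorem contDiff_radialBump : ContDiff ℝ (⊤ : ℕ∞) (radialBump (n := n)) :=
  Real.smoothTransition.contDiff.comp (contDiff_const.sub (contDiff_norm_sq ℝ))

theorem radialBump_nonneg (x : EuclideanSpace ℝ (Fin n)) : 0 ≤ radialBump x :=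
  Real.smoothTransition.nonneg _

theorem radialBump_zero : radialBump (0 : EuclideanSpace ℝ (Fin n)) = 1 := by
  simp [radialBump]

theorem radialBump_lt_one {x : EuclideanSpace ℝ (Fin n)} (hx : x ≠ 0) : radialBump x < 1 :=
  Real.smoothTransition.lt_one_of_lt_one (by have := norm_pos_iff.2 hx; nlinarith)

theorem radialBump_eq_zero {x : EuclideanSpace ℝ (Fin n)} (hx : 1 ≤ ‖x‖) : radialBump x = 0 :=
  Real.smoothTransition.zero_of_nonpos (by nlinarith)

theorem radialBump_anti {x y : EuclideanSpace ℝ (Fin n)} (h : ‖x‖ ≤ ‖y‖) :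
    radialBump y ≤ radialBump x :=
  Real.smoothTransition.monotone (by
    have := pow_le_pow_left₀ (norm_nonneg x) h 2
    linarith)

theorem radialBump_congr {x y : EuclideanSpace ℝ (Fin n)} (h : ‖x‖ = ‖y‖) :
    radialBump x = radialBump y := by
  simp [radialBump, h]

theorem hasCompactSupport_radialBump : HasCompactSupport (radialBump (n := n)) :=
  HasCompactSupport.intro (isCompact_closedBall 0 1) fun x hx =>
    radialBump_eq_zero (by simpa using (not_le.1 (by simpa using hx)).le)

/-- The sup bound uses `m` differences and the second-difference bound `m + 2`. Steps of length at
most 1 serve only to keep the support in the ball of radius `1 + m`. -/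
theorem exists_isTestBound_iterDiff_radialBump (n m : ℕ) :
    ∃ C : ℝ, 0 ≤ C ∧ ∀ l : List (EuclideanSpace ℝ (Fin n)), l.length = m →
      (∀ h ∈ l, ‖h‖ ≤ 1) →
      IsTestBound (1 + m) (C * (l.map norm).prod) (iterDiff l (radialBump (n := n))) := by
  obtain ⟨C₁, hC₁, h1⟩ := exists_norm_iterDiff_le (E := EuclideanSpace ℝ (Fin n)) m radialBump
    contDiff_radialBump hasCompactSupport_radialBump
  obtain ⟨C₂, hC₂, h2⟩ := exists_norm_iterDiff_le (E := EuclideanSpace ℝ (Fin n)) (m + 2) radialBump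
    contDiff_radialBump hasCompactSupport_radialBump
  refine ⟨max C₁ C₂, le_max_of_le_left hC₁, fun l hl hl1 => ?_⟩
  have hP : 0 ≤ (l.map norm).prod := List.prod_nonneg (by simp)
  refine ⟨continuous_iterDiff l contDiff_radialBump.continuous, fun x hx => ?_, fun x => ?_,
    fun x h => ?_⟩
  · exact iterDiff_eq_zero_of_norm_gt (R := 1) (fun y hy => radialBump_eq_zero hy.le) l hl1 x
      (by rwa [hl])
  · exact (h1 l hl x).trans (mul_le_mul_of_nonneg_right (le_max_left _ _) hP)
  · rw [secondDiff_iterDiff, abs_neg]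
    refine (h2 (h :: h :: l) (by simp [hl]) (x - h)).trans ?_
    have hh : ‖h‖ ^ (2 : ℝ) = ‖h‖ * ‖h‖ := by rw [Real.rpow_two, sq]
    rw [hh]
    simp only [List.map_cons, List.prod_cons]
    calc C₂ * (‖h‖ * (‖h‖ * (l.map norm).prod))
        ≤ max C₁ C₂ * (‖h‖ * (‖h‖ * (l.map norm).prod)) :=
          mul_le_mul_of_nonneg_right (le_max_right _ _) (by positivity)
      _ = _ := by ring

theorem exists_isTestBound_radialBump (n : ℕ) :
    ∃ C : ℝ, IsTestBound 1 C (radialBump (n := n)) := by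
  obtain ⟨C, -, h⟩ := exists_isTestBound_iterDiff_radialBump n 0
  exact ⟨C, by simpa [iterDiff] using h [] rfl (by simp)⟩

/-- The fractional Laplacian of the radial bump function. -/
noncomputable def bumpLaplacian {n : ℕ} (α : ℝ) : EuclideanSpace ℝ (Fin n) → ℝ :=
  symmLaplacian α radialBump

theorem continuous_bumpLaplacian (hn : 1 ≤ n) (hα : 0 < α) (hα₂ : α < 2) :
    Continuous (bumpLaplacian (n := n) α) := by
  obtain ⟨C, hC⟩ := exists_isTestBound_radialBump n
  exact hC.continuous_symmLaplacian hn hα hα₂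

theorem integrable_bumpLaplacian (hn : 1 ≤ n) (hα : 0 < α) (hα₂ : α < 2) :
    Integrable (bumpLaplacian (n := n) α) := by
  obtain ⟨C, hC⟩ := exists_isTestBound_radialBump n
  exact hC.integrable_symmLaplacian hn hα hα₂

theorem integral_bumpLaplacian (hn : 1 ≤ n) (hα : 0 < α) (hα₂ : α < 2) :
    ∫ x, bumpLaplacian (n := n) α x = 0 := by
  obtain ⟨C, hC⟩ := exists_isTestBound_radialBump n
  exact hC.integral_symmLaplacian hn hα hα₂

/-- The operator commutes with translations, so the differences can be taken on the bump itself,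
which is smooth. -/
theorem exists_integral_abs_iterDiff_bumpLaplacian_le (hn : 1 ≤ n) (hα : 0 < α) (hα₂ : α < 2)
    (m : ℕ) : ∃ C : ℝ, 0 ≤ C ∧ ∀ l : List (EuclideanSpace ℝ (Fin n)), l.length = m →
      (∀ h ∈ l, ‖h‖ ≤ 1) → Integrable (iterDiff l (bumpLaplacian α)) ∧
      ∫ x, |iterDiff l (bumpLaplacian α) x| ≤ C * (l.map norm).prod := by
  obtain ⟨C₀, h0⟩ := exists_isTestBound_radialBump n
  obtain ⟨C, hC, h⟩ := exists_isTestBound_iterDiff_radialBump n m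
  have hI : 0 ≤ ∫ h : EuclideanSpace ℝ (Fin n), min 1 (‖h‖ ^ (2 : ℝ)) * fracKernel α h :=
    integral_nonneg fun h => mul_nonneg (by positivity) (fracKernel_nonneg h)
  refine ⟨4 * volume.real (Metric.closedBall (0 : EuclideanSpace ℝ (Fin n)) (1 + m + 1)) *
        (∫ h : EuclideanSpace ℝ (Fin n), min 1 (‖h‖ ^ (2 : ℝ)) * fracKernel α h) * C,
        by positivity, fun l hl hl1 => ?_⟩
  have e : iterDiff l (bumpLaplacian α) = symmLaplacian α (iterDiff l radialBump) := by
    funext x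
    refine (iterDiff_integral l (fun y h => secondDiff radialBump y h * fracKernel α h)
      (h0.integrable_mul_fracKernel hn hα hα₂) x).1.trans ?_
    simp only [iterDiff_mul_const, iterDiff_secondDiff, symmLaplacian]
  rw [e]
  refine ⟨(h l hl hl1).integrable_symmLaplacian hn hα hα₂, ?_⟩
  rw [mul_assoc _ C]
  exact (h l hl hl1).integral_abs_symmLaplacian_le hn hα hα₂

/-- The reflection exchanging `x` and `y` is a measure-preserving isometry that leaves the bump and
the kernel invariant. -/
theorem bumpLaplacian_congr {x y : EuclideanSpace ℝ (Fin n)} (h : ‖x‖ = ‖y‖) :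
    bumpLaplacian α x = bumpLaplacian α y := by
  set T := Submodule.reflection (Submodule.span ℝ {x - y})ᗮ
  have hT : T x = y := Submodule.reflection_sub h
  have hm : MeasurePreserving T volume volume := T.measurePreserving
  have := hm.integral_comp T.toHomeomorph.measurableEmbedding
    (fun h => secondDiff radialBump y h * fracKernel α h)
  unfold bumpLaplacian symmLaplacian
  rw [← this]
  refine integral_congr_ae (ae_of_all _ fun k => ?_)
  simp only [secondDiff, fracKernel, ← hT, ← map_add, ← map_sub, LinearIsometryEquiv.norm_map]
  rw [radialBump_congr (T.norm_map x), radialBump_congr (T.norm_map (x + k)),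
    radialBump_congr (T.norm_map (x - k))]

theorem exists_abs_bumpLaplacian_le (n : ℕ) (hα : 0 < α) :
    ∃ C : ℝ, 0 ≤ C ∧ ∀ x : EuclideanSpace ℝ (Fin n), 2 ≤ ‖x‖ →
      |bumpLaplacian α x| ≤ C * ‖x‖ ^ (-((n : ℝ) + α)) := by
  obtain ⟨C₀, h0⟩ := exists_isTestBound_radialBump n
  have i0 := h0.integrable
  have hI : 0 ≤ ∫ x, radialBump (n := n) x := integral_nonneg radialBump_nonneg
  refine ⟨2 * (∫ x, radialBump (n := n) x) * 2 ^ ((n : ℝ) + α), by positivity, fun x hx => ?_⟩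
  have hp : 0 < (n : ℝ) + α := by positivity
  have hk : ∀ h : EuclideanSpace ℝ (Fin n), ‖x‖ / 2 ≤ ‖h‖ →
      fracKernel α h ≤ 2 ^ ((n : ℝ) + α) * ‖x‖ ^ (-((n : ℝ) + α)) := fun h hh => by
    have : 2 ^ ((n : ℝ) + α) * ‖x‖ ^ (-((n : ℝ) + α)) = ((‖x‖ / 2) ^ ((n : ℝ) + α))⁻¹ := by
      rw [Real.div_rpow (norm_nonneg _) (by norm_num), Real.rpow_neg (norm_nonneg _), inv_div,
        div_eq_mul_inv]
    rw [this, fracKernel]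
    have h3 : 0 < ‖x‖ / 2 := by linarith
    exact inv_anti₀ (by positivity) (Real.rpow_le_rpow h3.le hh hp.le)
  set D := 2 ^ ((n : ℝ) + α) * ‖x‖ ^ (-((n : ℝ) + α)) with hD
  -- Where the bump at `y = x ± h` is nonzero, `‖y‖ < 1 ≤ ‖x‖/2`, so `‖h‖ ≥ ‖x‖/2` and the kernel is
  -- at most `D`.
  have key : ∀ h y : EuclideanSpace ℝ (Fin n), ‖x‖ ≤ ‖y‖ + ‖h‖ →
      radialBump y * fracKernel α h ≤ radialBump y * D := fun h y hy => by
    by_cases h1 : 1 ≤ ‖y‖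
    · simp [radialBump_eq_zero h1]
    · exact mul_le_mul_of_nonneg_left (hk h (by linarith)) (radialBump_nonneg y)
  calc |bumpLaplacian α x| ≤ ∫ h, ‖secondDiff radialBump x h * fracKernel α h‖ :=
        norm_integral_le_integral_norm (fun h => secondDiff radialBump x h * fracKernel α h)
    _ ≤ ∫ h, (radialBump (x + h) * D + radialBump (x - h) * D) := by
        refine integral_mono_of_nonneg (ae_of_all _ fun _ => norm_nonneg _)
          (((i0.comp_add_left x).mul_const D).add ((i0.comp_sub_left x).mul_const D))
          (ae_of_all _ fun h => ?_)
        simp only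
        have e : secondDiff radialBump x h = -(radialBump (x + h) + radialBump (x - h)) := by
          rw [secondDiff, radialBump_eq_zero (by linarith : 1 ≤ ‖x‖)]; ring
        rw [e, neg_mul, norm_neg, Real.norm_of_nonneg (mul_nonneg (add_nonneg
          (radialBump_nonneg _) (radialBump_nonneg _)) (fracKernel_nonneg h)), add_mul]
        refine add_le_add (key h _ ?_) (key h _ ?_)
        · have := norm_sub_le (x + h) h; rwa [add_sub_cancel_right] at this
        · have := norm_add_le (x - h) h; rwa [sub_add_cancel] at this
    _ = 2 * (∫ x, radialBump (n := n) x) * D := by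
        rw [integral_add ((i0.comp_add_left x).mul_const D) ((i0.comp_sub_left x).mul_const D),
          integral_mul_const, integral_mul_const, integral_add_left_eq_self radialBump x,
          integral_sub_left_eq_self radialBump volume x]
        ring
    _ = _ := by rw [hD]; ring

/-- The substitution `x ↦ -h - x` and evenness turn twice the integral into that of `(a x -
a(x+h))(b x - b(x+h))`. Both factors have the same sign, since `a` and `b` decrease in the norm. -/
theorem integral_mul_sub_shift_nonneg {a b : EuclideanSpace ℝ (Fin n) → ℝ}
    (ha : ∀ x y, ‖x‖ ≤ ‖y‖ → a y ≤ a x) (hb : ∀ x y, ‖x‖ ≤ ‖y‖ → b y ≤ b x)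
    (hi : ∀ h, Integrable (fun x => a x * (b x - b (x + h)))) (h : EuclideanSpace ℝ (Fin n)) :
    0 ≤ ∫ x, a x * (b x - b (x + h)) := by
  have even : ∀ {f : EuclideanSpace ℝ (Fin n) → ℝ}, (∀ x y, ‖x‖ ≤ ‖y‖ → f y ≤ f x) →
      ∀ x, f (-x) = f x := fun hf x =>
    le_antisymm (hf _ _ (norm_neg x).ge) (hf _ _ (norm_neg x).le)
  have e : ∀ x, a (-h - x) * (b (-h - x) - b (-h - x + h)) = a (x + h) * (b (x + h) - b x) := by
    intro x
    rw [← even ha (x + h), ← even hb (x + h), ← even hb x]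
    congr 2 <;> congr 1 <;> abel_nf
  have i1 : Integrable fun x => a (x + h) * (b (x + h) - b x) := by
    have := (hi h).comp_sub_left (-h)
    simpa only [e] using this
  have e1 : ∫ x, a x * (b x - b (x + h)) = ∫ x, a (x + h) * (b (x + h) - b x) := by
    rw [← integral_sub_left_eq_self (fun x => a x * (b x - b (x + h))) volume (-h)]
    simp only [e]
  have e2 : 2 * ∫ x, a x * (b x - b (x + h)) = ∫ x, (a x - a (x + h)) * (b x - b (x + h)) := by
    rw [two_mul]; nth_rw 2 [e1]
    rw [← integral_add (hi h) i1]
    congr 1; ext x; ring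
  have : 0 ≤ ∫ x, (a x - a (x + h)) * (b x - b (x + h)) := by
    refine integral_nonneg fun x => ?_
    rcases le_total ‖x‖ ‖x + h‖ with h1 | h1
    · exact mul_nonneg (sub_nonneg.2 (ha _ _ h1)) (sub_nonneg.2 (hb _ _ h1))
    · exact mul_nonneg_of_nonpos_of_nonpos (sub_nonpos.2 (ha _ _ h1)) (sub_nonpos.2 (hb _ _ h1))
  linarith

/-- After Fubini, the second difference splits into the shifts by `h` and `-h`, each nonnegative
against the radially decreasing indicator of the ball. This is the source of `meanKernel_nonneg`. -/
theorem integral_ball_bumpLaplacian_nonneg (hn : 1 ≤ n) (hα : 0 < α) (hα₂ : α < 2) (r : ℝ) :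
    0 ≤ ∫ x : EuclideanSpace ℝ (Fin n), (Iio r).indicator (fun _ => (1 : ℝ)) ‖x‖ *
      bumpLaplacian α x := by
  obtain ⟨C₀, h0⟩ := exists_isTestBound_radialBump n
  have i0 := h0.integrable
  set a : EuclideanSpace ℝ (Fin n) → ℝ := fun x => (Iio r).indicator (fun _ => (1 : ℝ)) ‖x‖ with ha
  have am : Measurable a := (measurable_const.indicator measurableSet_Iio).comp measurable_norm
  have ab : ∀ x, |a x| ≤ 1 := fun x => by
    simp only [ha]
    by_cases hx : ‖x‖ ∈ Iio r
    · rw [indicator_of_mem hx]; simp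
    · rw [indicator_of_notMem hx]; simp
  have aa : ∀ x y : EuclideanSpace ℝ (Fin n), ‖x‖ ≤ ‖y‖ → a y ≤ a x := fun x y hxy => by
    simp only [ha]
    by_cases hy : ‖y‖ ∈ Iio r
    · rw [indicator_of_mem hy, indicator_of_mem (show ‖x‖ ∈ Iio r from hxy.trans_lt hy)]
    · rw [indicator_of_notMem hy]
      exact indicator_nonneg (fun _ _ => zero_le_one) _
  have hi : ∀ h, Integrable (fun x => a x * (radialBump x - radialBump (x + h))) := fun h =>
    (i0.sub (i0.comp_add_right h)).bdd_mul am.aestronglyMeasurable (ae_of_all _ ab)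
  rw [bumpLaplacian, h0.integral_mul_symmLaplacian hn hα hα₂ am.aestronglyMeasurable ab]
  refine integral_nonneg fun h => mul_nonneg ?_ (fracKernel_nonneg h)
  have e : ∀ x, a x * secondDiff radialBump x h =
      a x * (radialBump x - radialBump (x + h)) + a x * (radialBump x - radialBump (x + -h)) := by
    intro x; rw [secondDiff, ← sub_eq_add_neg]; ring
  simp only [e]
  rw [integral_add (hi h) (hi (-h))]
  exact add_nonneg
    (integral_mul_sub_shift_nonneg aa (fun x y => radialBump_anti) hi h)
    (integral_mul_sub_shift_nonneg aa (fun x y => radialBump_anti) hi (-h))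

/-- The bump has a strict maximum at the origin, so the integrand is positive off 0. -/
theorem bumpLaplacian_zero_pos (hn : 1 ≤ n) (hα : 0 < α) (hα₂ : α < 2) :
    0 < bumpLaplacian α (0 : EuclideanSpace ℝ (Fin n)) := by
  have : Nontrivial (EuclideanSpace ℝ (Fin n)) := by
    have : Nonempty (Fin n) := ⟨⟨0, hn⟩⟩
    infer_instance
  obtain ⟨C₀, h0⟩ := exists_isTestBound_radialBump n
  have e : ∀ h : EuclideanSpace ℝ (Fin n), secondDiff radialBump 0 h = 2 * (1 - radialBump h) := by
    intro h
    rw [secondDiff, zero_add, zero_sub, radialBump_congr (norm_neg h), radialBump_zero]; ring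
  have hpos : ∀ h : EuclideanSpace ℝ (Fin n), h ≠ 0 →
      0 < secondDiff radialBump 0 h * fracKernel α h := fun h hh => by
    have := radialBump_lt_one hh
    have h2 := norm_pos_iff.2 hh
    rw [e]
    refine mul_pos (by linarith) ?_
    unfold fracKernel; positivity
  refine (integral_pos_iff_support_of_nonneg (fun h => ?_)
    (h0.integrable_mul_fracKernel hn hα hα₂ 0)).2 ?_
  · by_cases hh : h = 0
    · simp [hh, secondDiff]; linarith
    · exact (hpos h hh).le
  · have hsub : ({0}ᶜ : Set (EuclideanSpace ℝ (Fin n))) ⊆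
        Function.support fun h => secondDiff radialBump 0 h * fracKernel α h :=
      fun h hh => (hpos h hh).ne'
    exact (isOpen_compl_singleton.measure_pos volume
      (nonempty_compl_of_nontrivial (0 : EuclideanSpace ℝ (Fin n)))).trans_le (measure_mono hsub)

end RadialBump

/-! ### The averaging kernel M: sign, decay and L¹ differences. -/

/-- The averaging kernel `∫₀¹ σ^(n-1) ψ(σ x) dσ` built from the fractional Laplacian `ψ` of a bump
function; up to a constant, bounded `α`-harmonic functions are reproduced by it. -/
noncomputable def meanKernel {n : ℕ} (α : ℝ) (x : EuclideanSpace ℝ (Fin n)) : ℝ :=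
  ∫ σ in (0 : ℝ)..1, σ ^ (n - 1) * bumpLaplacian α (σ • x)

section MeanKernel

variable {n : ℕ} {α : ℝ}

theorem continuous_meanKernel (hn : 1 ≤ n) (hα : 0 < α) (hα₂ : α < 2) :
    Continuous (meanKernel (n := n) α) := by
  have := continuous_bumpLaplacian (n := n) hn hα hα₂
  unfold meanKernel
  refine intervalIntegral.continuous_parametric_intervalIntegral_of_continuous'
    (f := fun (x : EuclideanSpace ℝ (Fin n)) (σ : ℝ) => σ ^ (n - 1) * bumpLaplacian α (σ • x)) ?_ 0 1
  simp only [Function.uncurry_def]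
  fun_prop

theorem meanKernel_congr {x y : EuclideanSpace ℝ (Fin n)} (h : ‖x‖ = ‖y‖) :
    meanKernel α x = meanKernel α y := by
  unfold meanKernel
  congr 1
  ext σ
  rw [bumpLaplacian_congr (x := σ • x) (y := σ • y) (by rw [norm_smul, norm_smul, h])]

/-- Substitution `τ = tσ`. Dilates of the kernel at two scales thus differ by an integral of dilates
of ψ over the scales in between. -/
theorem pow_mul_meanKernel_smul (hn : 1 ≤ n) (t : ℝ) (x : EuclideanSpace ℝ (Fin n)) :
    t ^ n * meanKernel α (t • x) = ∫ τ in (0 : ℝ)..t, τ ^ (n - 1) * bumpLaplacian α (τ • x) := by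
  have h := intervalIntegral.smul_integral_comp_mul_left (a := 0) (b := 1)
    (fun τ : ℝ => τ ^ (n - 1) * bumpLaplacian α (τ • x)) t
  rw [mul_zero, mul_one] at h
  rw [← h, meanKernel, smul_eq_mul, ← intervalIntegral.integral_const_mul,
    ← intervalIntegral.integral_const_mul]
  congr 1
  ext σ
  obtain ⟨k, rfl⟩ : ∃ k, n = k + 1 := ⟨n - 1, by omega⟩
  rw [mul_comm t σ, mul_smul, Nat.add_sub_cancel]
  ring

theorem bumpLaplacian_eq_norm {e : EuclideanSpace ℝ (Fin n)} (he : ‖e‖ = 1)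
    (x : EuclideanSpace ℝ (Fin n)) : bumpLaplacian α x = bumpLaplacian α (‖x‖ • e) :=
  bumpLaplacian_congr (by rw [norm_smul, he, norm_norm, mul_one])

theorem exists_norm_eq_one (hn : 1 ≤ n) : ∃ e : EuclideanSpace ℝ (Fin n), ‖e‖ = 1 :=
  ⟨EuclideanSpace.single ⟨0, hn⟩ 1, by simp⟩

/-- This is `∫ ψ = 0` in polar coordinates, the cancellation responsible for the decay of the
averaging kernel. -/
theorem integral_Ioi_bumpLaplacian (hn : 1 ≤ n) (hα : 0 < α) (hα₂ : α < 2)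
    {e : EuclideanSpace ℝ (Fin n)} (he : ‖e‖ = 1) :
    IntegrableOn (fun τ : ℝ => τ ^ (n - 1) * bumpLaplacian α (τ • e)) (Ioi 0) ∧
      ∫ τ in Ioi (0 : ℝ), τ ^ (n - 1) * bumpLaplacian α (τ • e) = 0 := by
  have : Nontrivial (EuclideanSpace ℝ (Fin n)) := ⟨e, 0, fun h => by simp [h] at he⟩
  have h1 := integrable_bumpLaplacian (n := n) hn hα hα₂
  have h2 := integral_bumpLaplacian (n := n) hn hα hα₂
  rw [funext (bumpLaplacian_eq_norm (α := α) he)] at h1 h2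
  rw [integrable_fun_norm_addHaar volume (f := fun s => bumpLaplacian α (s • e))] at h1
  rw [integral_fun_norm_addHaar volume (fun s => bumpLaplacian α (s • e))] at h2
  simp only [finrank_euclideanSpace, Fintype.card_fin, smul_eq_mul, nsmul_eq_mul] at h1 h2
  refine ⟨h1, ?_⟩
  have hv : 0 < volume.real (Metric.ball (0 : EuclideanSpace ℝ (Fin n)) 1) :=
    ENNReal.toReal_pos (Metric.measure_ball_pos _ _ one_pos).ne' measure_ball_lt_top.ne
  have hn' : (n : ℝ) ≠ 0 := by positivity
  simpa [hn', hv.ne'] using h2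

theorem integral_bumpLaplacian_radial_nonneg (hn : 1 ≤ n) (hα : 0 < α) (hα₂ : α < 2)
    {e : EuclideanSpace ℝ (Fin n)} (he : ‖e‖ = 1) {r : ℝ} (hr : 0 ≤ r) :
    0 ≤ ∫ τ in (0 : ℝ)..r, τ ^ (n - 1) * bumpLaplacian α (τ • e) := by
  have : Nontrivial (EuclideanSpace ℝ (Fin n)) := ⟨e, 0, fun h => by simp [h] at he⟩
  have h2 := integral_ball_bumpLaplacian_nonneg (n := n) hn hα hα₂ r
  rw [integral_congr_ae (ae_of_all _ fun x => by rw [bumpLaplacian_eq_norm he x]),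
    integral_fun_norm_addHaar volume
      (fun s => (Iio r).indicator (fun _ => (1 : ℝ)) s * bumpLaplacian α (s • e))] at h2
  simp only [finrank_euclideanSpace, Fintype.card_fin, smul_eq_mul, nsmul_eq_mul] at h2
  have hv : 0 < volume.real (Metric.ball (0 : EuclideanSpace ℝ (Fin n)) 1) :=
    ENNReal.toReal_pos (Metric.measure_ball_pos _ _ one_pos).ne' measure_ball_lt_top.ne
  have hn' : 0 < (n : ℝ) := by positivity
  have h3 := nonneg_of_mul_nonneg_right (nonneg_of_mul_nonneg_right h2 hn') hv
  rw [intervalIntegral.integral_of_le hr, integral_Ioc_eq_integral_Ioo]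
  have e1 : ∀ y : ℝ, y ^ (n - 1) * ((Iio r).indicator (fun _ => (1 : ℝ)) y *
      bumpLaplacian α (y • e)) = (Iio r).indicator
        (fun y => y ^ (n - 1) * bumpLaplacian α (y • e)) y := fun y => by
    by_cases hy : y ∈ Iio r
    · rw [indicator_of_mem hy, indicator_of_mem hy, one_mul]
    · rw [indicator_of_notMem hy, indicator_of_notMem hy, zero_mul, mul_zero]
  simp only [e1] at h3
  rwa [setIntegral_indicator measurableSet_Iio, Ioi_inter_Iio] at h3

theorem meanKernel_nonneg (hn : 1 ≤ n) (hα : 0 < α) (hα₂ : α < 2)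
    (x : EuclideanSpace ℝ (Fin n)) : 0 ≤ meanKernel α x := by
  obtain ⟨e, he⟩ := exists_norm_eq_one hn
  have h1 : meanKernel α x = ∫ τ in (0 : ℝ)..1, τ ^ (n - 1) * bumpLaplacian α (τ • (‖x‖ • e)) := by
    rw [meanKernel_congr (x := x) (y := ‖x‖ • e) (by rw [norm_smul, he, norm_norm, mul_one])]
    rfl
  -- The scaling identity with `t = ‖x‖` says nothing at the origin, where positivity of ψ(0) is
  -- used instead.
  rcases eq_or_ne x 0 with rfl | hx
  · rw [h1]
    refine intervalIntegral.integral_nonneg zero_le_one fun τ hτ => ?_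
    simp only [norm_zero, zero_smul, smul_zero]
    exact mul_nonneg (pow_nonneg hτ.1 _) (bumpLaplacian_zero_pos hn hα hα₂).le
  · have h2 : 0 ≤ ‖x‖ ^ n * meanKernel α (‖x‖ • e) := by
      rw [pow_mul_meanKernel_smul hn]
      exact integral_bumpLaplacian_radial_nonneg hn hα hα₂ he (norm_nonneg x)
    have h3 := nonneg_of_mul_nonneg_right h2 (pow_pos (norm_pos_iff.2 hx) n)
    rwa [meanKernel_congr (x := x) (y := ‖x‖ • e) (by rw [norm_smul, he, norm_norm, mul_one])]

/-- By cancellation `‖x‖^n M(x)` is minus the tail of the radial integral of ψ beyond `‖x‖`, and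
that tail is at most `∫ C τ^(-α-1) = C ‖x‖^(-α)/α`. -/
theorem exists_abs_meanKernel_le (hn : 1 ≤ n) (hα : 0 < α) (hα₂ : α < 2) :
    ∃ C : ℝ, 0 ≤ C ∧ ∀ x : EuclideanSpace ℝ (Fin n), 2 ≤ ‖x‖ →
      |meanKernel α x| ≤ C * ‖x‖ ^ (-((n : ℝ) + α)) := by
  obtain ⟨e, he⟩ := exists_norm_eq_one hn
  obtain ⟨C, hC0, hC⟩ := exists_abs_bumpLaplacian_le n hα
  refine ⟨C / α, by positivity, fun x hx => ?_⟩
  obtain ⟨hi, h0⟩ := integral_Ioi_bumpLaplacian hn hα hα₂ he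
  have hx0 : 0 < ‖x‖ := by linarith
  have h1 : ‖x‖ ^ n * meanKernel α x =
      -∫ τ in Ioi ‖x‖, τ ^ (n - 1) * bumpLaplacian α (τ • e) := by
    rw [meanKernel_congr (x := x) (y := ‖x‖ • e) (by rw [norm_smul, he, norm_norm, mul_one]),
      pow_mul_meanKernel_smul hn, intervalIntegral.integral_of_le hx0.le]
    rw [← Ioc_union_Ioi_eq_Ioi hx0.le, setIntegral_union Ioc_disjoint_Ioi_same measurableSet_Ioi
      (hi.mono_set Ioc_subset_Ioi_self) (hi.mono_set (Ioi_subset_Ioi hx0.le))] at h0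
    linarith
  have h2 : |∫ τ in Ioi ‖x‖, τ ^ (n - 1) * bumpLaplacian α (τ • e)| ≤
      ∫ τ in Ioi ‖x‖, C * τ ^ (-α - 1) := by
    rw [← Real.norm_eq_abs]
    refine norm_integral_le_of_norm_le
      ((integrableOn_Ioi_rpow_of_lt (a := -α - 1) (by linarith) hx0).const_mul C)
      ((ae_restrict_iff' measurableSet_Ioi).2 (ae_of_all _ fun τ hτ => ?_))
    have hτ : ‖x‖ < τ := hτ
    have hτ0 : 0 < τ := by linarith
    have hn1 : ‖τ • e‖ = τ := by rw [norm_smul, he, mul_one, Real.norm_of_nonneg hτ0.le]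
    have := hC (τ • e) (by linarith)
    rw [hn1] at this
    rw [norm_mul, Real.norm_of_nonneg (by positivity), Real.norm_eq_abs]
    calc τ ^ (n - 1) * |bumpLaplacian α (τ • e)| ≤ τ ^ (n - 1) * (C * τ ^ (-((n : ℝ) + α))) :=
          mul_le_mul_of_nonneg_left this (by positivity)
      _ = C * (τ ^ (n - 1) * τ ^ (-((n : ℝ) + α))) := by ring
      _ = C * τ ^ (-α - 1) := by
        rw [← Real.rpow_natCast, ← Real.rpow_add hτ0]
        push_cast [hn]; ring_nf
  rw [integral_const_mul, integral_Ioi_rpow_of_lt (by linarith) hx0, sub_add_cancel,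
    neg_div_neg_eq] at h2
  have h3 : ‖x‖ ^ n * |meanKernel α x| ≤ C * (‖x‖ ^ (-α) / α) := by
    rw [← abs_of_pos (pow_pos hx0 n), ← abs_mul, h1, abs_neg]; exact h2
  have h4 : ‖x‖ ^ (-((n : ℝ) + α)) = ‖x‖ ^ (-α) / ‖x‖ ^ n := by
    rw [neg_add_rev, ← sub_eq_add_neg, Real.rpow_sub hx0, Real.rpow_natCast]
  rw [h4, div_mul_div_comm, le_div_iff₀ (by positivity)]
  have h5 : C * (‖x‖ ^ (-α) / α) * α = C * ‖x‖ ^ (-α) := by field_simp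
  nlinarith

theorem integrable_meanKernel (hn : 1 ≤ n) (hα : 0 < α) (hα₂ : α < 2) :
    Integrable (meanKernel (n := n) α) := by
  obtain ⟨C, hC0, hC⟩ := exists_abs_meanKernel_le (n := n) hn hα hα₂
  have hc := continuous_meanKernel (n := n) hn hα hα₂
  have h1 : IntegrableOn (meanKernel (n := n) α) (Metric.closedBall 0 2) :=
    hc.continuousOn.integrableOn_compact (isCompact_closedBall 0 2)
  have h2 : IntegrableOn (meanKernel (n := n) α) {x | 2 ≤ ‖x‖} := by
    refine ((integrableOn_fracKernel hn hα two_pos).const_mul C).mono'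
      hc.aestronglyMeasurable.restrict
      ((ae_restrict_iff' (measurableSet_le_norm 2)).2 (ae_of_all _ fun x hx => ?_))
    have := hC x hx
    rwa [Real.rpow_neg (norm_nonneg x)] at this
  have h3 := h1.union h2
  rwa [show Metric.closedBall (0 : EuclideanSpace ℝ (Fin n)) 2 ∪ {x | 2 ≤ ‖x‖} = univ from
    eq_univ_of_forall fun x => by simpa using le_total ‖x‖ 2, integrableOn_univ] at h3

theorem integral_meanKernel_pos (hn : 1 ≤ n) (hα : 0 < α) (hα₂ : α < 2) :
    0 < ∫ x : EuclideanSpace ℝ (Fin n), meanKernel α x := by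
  have hc := continuous_meanKernel (n := n) hn hα hα₂
  refine (integral_pos_iff_support_of_nonneg (meanKernel_nonneg hn hα hα₂)
    (integrable_meanKernel hn hα hα₂)).2 ?_
  refine hc.isOpen_support.measure_pos volume ⟨0, ?_⟩
  have : 0 < meanKernel α (0 : EuclideanSpace ℝ (Fin n)) := by
    unfold meanKernel
    refine intervalIntegral.intervalIntegral_pos_of_pos_on ?_ (fun τ hτ => ?_) one_pos
    · refine Continuous.intervalIntegrable ?_ _ _
      have := continuous_bumpLaplacian (n := n) hn hα hα₂
      fun_prop
    · rw [smul_zero]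
      exact mul_pos (pow_pos hτ.1 _) (bumpLaplacian_zero_pos hn hα hα₂)
  exact this.ne'

theorem prod_map_norm_smul {E : Type*} [NormedAddCommGroup E] [NormedSpace ℝ E] {t : ℝ}
    (ht : 0 ≤ t) (l : List E) :
    ((l.map (t • ·)).map norm).prod = t ^ l.length * (l.map norm).prod := by
  induction l with
  | nil => simp
  | cons k l ih =>
    simp only [List.map_cons, List.prod_cons, ih, norm_smul, Real.norm_of_nonneg ht,
      List.length_cons, pow_succ]
    ring

theorem norm_le_one_of_mem_map_smul {E : Type*} [NormedAddCommGroup E] [NormedSpace ℝ E] {t : ℝ}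
    (ht : 0 < t) {l : List E} (hl : ∀ h ∈ l, ‖h‖ ≤ t⁻¹) : ∀ h ∈ l.map (t • ·), ‖h‖ ≤ 1 := by
  intro h hh
  obtain ⟨k, hk, rfl⟩ := List.mem_map.1 hh
  rw [norm_smul, Real.norm_of_nonneg ht.le, mul_comm]
  exact (le_div_iff₀ ht).1 (by simpa using hl k hk)

/-- M averages dilates of ψ. At scale σ the weight gives `σ^(n-1)`, the change of variables `σ^(-n)`
and the `m` shrunken steps `σ^m`. The total `σ^(m-1)` stays bounded on `(0, 1]` because `m ≥ 1`. -/
theorem exists_integral_abs_iterDiff_meanKernel_le (hn : 1 ≤ n) (hα : 0 < α) (hα₂ : α < 2)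
    {m : ℕ} (hm : 1 ≤ m) : ∃ C : ℝ, 0 ≤ C ∧
      ∀ l : List (EuclideanSpace ℝ (Fin n)), l.length = m → (∀ h ∈ l, ‖h‖ ≤ 1) →
      Integrable (iterDiff l (meanKernel α)) ∧
      ∫ x, |iterDiff l (meanKernel α) x| ≤ C * (l.map norm).prod := by
  obtain ⟨C, hC0, hC⟩ := exists_integral_abs_iterDiff_bumpLaplacian_le (n := n) hn hα hα₂ m
  refine ⟨C, hC0, fun l hl hl1 => ?_⟩
  have hP : 0 ≤ (l.map norm).prod := List.prod_nonneg (by simp)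
  have hψ := continuous_bumpLaplacian (n := n) hn hα hα₂
  let F : EuclideanSpace ℝ (Fin n) → ℝ → ℝ := fun x σ =>
    σ ^ (n - 1) * iterDiff (l.map (σ • ·)) (bumpLaplacian α) (σ • x)
  have hFe : ∀ x σ, iterDiff l (fun y => σ ^ (n - 1) * bumpLaplacian α (σ • y)) x = F x σ :=
    fun x σ => by rw [iterDiff_const_mul, iterDiff_comp_smul]
  have hF : Continuous (Function.uncurry F) := by
    have : ∀ l : List (EuclideanSpace ℝ (Fin n)),
        Continuous fun p : EuclideanSpace ℝ (Fin n) × ℝ =>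
          iterDiff l (fun y => p.2 ^ (n - 1) * bumpLaplacian α (p.2 • y)) p.1 := by
      intro l
      induction l with
      | nil => simp only [iterDiff]; fun_prop
      | cons k l ih =>
        simp only [iterDiff]
        exact (ih.comp (by fun_prop :
          Continuous fun p : EuclideanSpace ℝ (Fin n) × ℝ => (p.1 + k, p.2))).sub ih
    exact (this l).congr fun p => hFe p.1 p.2
  have e : ∀ x, iterDiff l (meanKernel α) x = ∫ σ in Ioc (0 : ℝ) 1, F x σ := by
    intro x
    have h1 : meanKernel (n := n) α = fun x =>
        ∫ σ in Ioc (0 : ℝ) 1, σ ^ (n - 1) * bumpLaplacian α (σ • x) := by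
      funext x; rw [meanKernel, intervalIntegral.integral_of_le zero_le_one]
    rw [h1, (iterDiff_integral l _ (fun x => ?_) x).1]
    · simp only [hFe]
    · have : Continuous fun σ : ℝ => σ ^ (n - 1) * bumpLaplacian α (σ • x) := by fun_prop
      exact (this.integrableOn_Icc (a := 0) (b := 1)).mono_set Ioc_subset_Icc_self
  have hb : ∀ σ ∈ Ioc (0 : ℝ) 1, Integrable (fun x => F x σ) ∧
      ∫ x, ‖F x σ‖ ≤ C * (l.map norm).prod := by
    intro σ hσ
    obtain ⟨i1, i2⟩ := hC (l.map (σ • ·)) (by simp [hl])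
      (norm_le_one_of_mem_map_smul hσ.1 fun h hh => (hl1 h hh).trans ((one_le_inv₀ hσ.1).2 hσ.2))
    refine ⟨(i1.comp_smul hσ.1.ne').const_mul _, ?_⟩
    simp only [F, norm_mul, Real.norm_eq_abs]
    rw [integral_const_mul, Measure.integral_comp_smul volume
      (fun x => |iterDiff (l.map (σ • ·)) (bumpLaplacian α) x|), prod_map_norm_smul hσ.1.le, hl] at *
    rw [abs_of_pos (pow_pos hσ.1 _), finrank_euclideanSpace, Fintype.card_fin,
      abs_of_pos (inv_pos.2 (pow_pos hσ.1 _)), smul_eq_mul]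
    have hσ0 := hσ.1
    have e2 : σ ^ (n - 1) * (σ ^ n)⁻¹ * σ ^ m = σ ^ (m - 1) := by
      obtain ⟨k, rfl⟩ : ∃ k, n = k + 1 := ⟨n - 1, by omega⟩
      obtain ⟨j, rfl⟩ : ∃ j, m = j + 1 := ⟨m - 1, by omega⟩
      simp only [Nat.add_sub_cancel]
      field_simp
      ring
    calc _ ≤ σ ^ (n - 1) * ((σ ^ n)⁻¹ * (C * (σ ^ m * (l.map norm).prod))) := by gcongr
      _ = C * (l.map norm).prod * (σ ^ (n - 1) * (σ ^ n)⁻¹ * σ ^ m) := by ring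
      _ = C * (l.map norm).prod * σ ^ (m - 1) := by rw [e2]
      _ ≤ _ := mul_le_of_le_one_right (by positivity) (pow_le_one₀ hσ.1.le hσ.2)
  have hfin : Integrable (fun _ : ℝ => C * (l.map norm).prod) (volume.restrict (Ioc (0 : ℝ) 1)) :=
    integrableOn_const (by simp)
  have hm1 : AEStronglyMeasurable (Function.uncurry F)
      ((volume : Measure (EuclideanSpace ℝ (Fin n))).prod (volume.restrict (Ioc (0 : ℝ) 1))) :=
    hF.aestronglyMeasurable
  have hint : Integrable (Function.uncurry F)
      ((volume : Measure (EuclideanSpace ℝ (Fin n))).prod (volume.restrict (Ioc (0 : ℝ) 1))) := by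
    refine (integrable_prod_iff' hm1).2 ⟨(ae_restrict_iff' measurableSet_Ioc).2
      (ae_of_all _ fun σ hσ => (hb σ hσ).1), ?_⟩
    refine hfin.mono' hm1.norm.prod_swap.integral_prod_right'
      ((ae_restrict_iff' measurableSet_Ioc).2 (ae_of_all _ fun σ hσ => ?_))
    rw [Real.norm_of_nonneg (integral_nonneg fun _ => norm_nonneg _)]
    exact (hb σ hσ).2
  have e' : iterDiff l (meanKernel α) = fun x => ∫ σ in Ioc (0 : ℝ) 1, F x σ := funext e
  rw [e']
  refine ⟨hint.integral_prod_left, ?_⟩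
  calc ∫ x, |∫ σ in Ioc (0 : ℝ) 1, F x σ| ≤ ∫ x, ∫ σ in Ioc (0 : ℝ) 1, ‖F x σ‖ :=
        integral_mono hint.integral_prod_left.abs hint.norm.integral_prod_left
          fun x => norm_integral_le_integral_norm (F x)
    _ = ∫ σ in Ioc (0 : ℝ) 1, ∫ x, ‖F x σ‖ := integral_integral_swap hint.norm
    _ ≤ ∫ σ in Ioc (0 : ℝ) 1, C * (l.map norm).prod :=
        integral_mono_ae hint.norm.integral_prod_right hfin
          ((ae_restrict_iff' measurableSet_Ioc).2 (ae_of_all _ fun σ hσ => (hb σ hσ).2))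
    _ = _ := by simp

end MeanKernel

/-! ### Reproduction of bounded harmonic functions and the interior estimate. -/

/-- A measurable function bounded by `B`, continuous on `S`, with second differences at the points
of `S` of order higher than `α`, whose fractional Laplacian vanishes on `S`. -/
structure IsBddHarmonicOn {n : ℕ} (α B : ℝ) (w : EuclideanSpace ℝ (Fin n) → ℝ)
    (S : Set (EuclideanSpace ℝ (Fin n))) : Prop where
  aestronglyMeasurable : AEStronglyMeasurable w volume
  abs_le : ∀ x, |w x| ≤ B
  continuousAt : ∀ x ∈ S, ContinuousAt w x
  exists_secondDiff_le : ∃ s C : ℝ, α < s ∧ 0 ≤ C ∧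
    ∀ x ∈ S, ∀ h, |secondDiff w x h| ≤ C * min 1 (‖h‖ ^ s)
  symmLaplacian_eq_zero : ∀ x ∈ S, symmLaplacian α w x = 0

namespace IsBddHarmonicOn

variable {n : ℕ} {α B : ℝ} {w : EuclideanSpace ℝ (Fin n) → ℝ}
  {S : Set (EuclideanSpace ℝ (Fin n))}

theorem mono {S' : Set (EuclideanSpace ℝ (Fin n))} (hw : IsBddHarmonicOn α B w S) (h : S' ⊆ S) :
    IsBddHarmonicOn α B w S' where
  aestronglyMeasurable := hw.aestronglyMeasurable
  abs_le := hw.abs_le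
  continuousAt := fun x hx => hw.continuousAt x (h hx)
  exists_secondDiff_le := by
    obtain ⟨s, C, h1, h2, h3⟩ := hw.exists_secondDiff_le
    exact ⟨s, C, h1, h2, fun x hx => h3 x (h hx)⟩
  symmLaplacian_eq_zero := fun x hx => hw.symmLaplacian_eq_zero x (h hx)

/-- After rescaling by `τ⁻¹ ≤ r`, the unit ball carrying the bump lands in the ball where `w` is
harmonic, and symmetry of the operator applies. -/
theorem integral_mul_bumpLaplacian (hn : 1 ≤ n) (hα : 0 < α) (hα₂ : α < 2)
    {x : EuclideanSpace ℝ (Fin n)} {r : ℝ} (hr : 0 < r)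
    (hw : IsBddHarmonicOn α B w (Metric.closedBall x r)) {τ : ℝ} (hτ : r⁻¹ ≤ τ) :
    ∫ z, w (x + z) * bumpLaplacian α (τ • z) = 0 := by
  have hτ0 : 0 < τ := (inv_pos.2 hr).trans_le hτ
  have hτr : τ⁻¹ ≤ r := inv_le_of_inv_le₀ hr hτ
  obtain ⟨C₀, h0⟩ := exists_isTestBound_radialBump n
  obtain ⟨s, C, hs, hC0, hC⟩ := hw.exists_secondDiff_le
  have hmem : ∀ z : EuclideanSpace ℝ (Fin n), ‖z‖ ≤ 1 →
      x + τ⁻¹ • z ∈ Metric.closedBall x r := fun z hz => by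
    rw [Metric.mem_closedBall, dist_eq_norm, add_sub_cancel_left, norm_smul,
      Real.norm_of_nonneg (inv_pos.2 hτ0).le]
    calc τ⁻¹ * ‖z‖ ≤ τ⁻¹ * 1 := by gcongr
      _ ≤ r := by rwa [mul_one]
  have hm : AEStronglyMeasurable (fun z => w (x + τ⁻¹ • z)) volume :=
    (hw.aestronglyMeasurable.comp_measurePreserving
      (measurePreserving_add_left volume x)).comp_quasiMeasurePreserving
      (Measure.quasiMeasurePreserving_smul volume (inv_pos.2 hτ0).ne')
  have key : ∫ z, w (x + τ⁻¹ • z) * bumpLaplacian α z = 0 := by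
    refine h0.integral_mul_symmLaplacian_eq_zero hn hα hα₂ hm (B := B) (fun z => hw.abs_le _) hs
      -- The maximum absorbs the dilation: `min 1 (τ⁻¹^s ‖h‖^s)` is at most `max 1 (τ⁻¹^s)` times
      -- `min 1 (‖h‖^s)`.
      (C := C * max 1 ((τ⁻¹) ^ s)) (fun z hz h => ?_) fun z hz => ?_
    · have e : secondDiff (fun z => w (x + τ⁻¹ • z)) z h =
          secondDiff w (x + τ⁻¹ • z) (τ⁻¹ • h) := by
        simp only [secondDiff, smul_add, smul_sub, add_assoc, add_sub_assoc]
      rw [e, mul_assoc]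
      refine (hC _ (hmem z hz) _).trans (mul_le_mul_of_nonneg_left ?_ hC0)
      rw [norm_smul, Real.norm_of_nonneg (inv_pos.2 hτ0).le,
        Real.mul_rpow (inv_pos.2 hτ0).le (norm_nonneg _)]
      have hp : 0 ≤ ‖h‖ ^ s := by positivity
      rcases min_choice 1 (‖h‖ ^ s) with h1 | h1 <;> rw [h1]
      · exact (min_le_left _ _).trans (by simp)
      · exact (min_le_right _ _).trans (mul_le_mul_of_nonneg_right (le_max_right _ _) hp)
    · exact symmLaplacian_comp_add_smul w (inv_pos.2 hτ0) x z
        (hw.symmLaplacian_eq_zero _ (hmem z hz))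
  have := Measure.integral_comp_smul volume
    (fun z => w (x + τ⁻¹ • z) * bumpLaplacian α z) τ
  rw [key, smul_zero] at this
  simpa only [inv_smul_smul₀ hτ0.ne'] using this

theorem integrable_mul_shift (hw : IsBddHarmonicOn α B w S) (x : EuclideanSpace ℝ (Fin n))
    {f : EuclideanSpace ℝ (Fin n) → ℝ} (hf : Integrable f) :
    Integrable fun z => w (x + z) * f z :=
  hf.bdd_mul (c := B) (hw.aestronglyMeasurable.comp_measurePreserving
    (measurePreserving_add_left volume x)) (ae_of_all _ fun _ => hw.abs_le _)

/-- The two sides differ by the integral over `τ` between `r⁻¹` and `t` of `τ^(n-1) ∫ w(x+z) ψ(τz)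
dz`, which is zero at each such scale. -/
theorem integral_mul_meanKernel_eq (hn : 1 ≤ n) (hα : 0 < α) (hα₂ : α < 2)
    {x : EuclideanSpace ℝ (Fin n)} {r : ℝ} (hr : 0 < r)
    (hw : IsBddHarmonicOn α B w (Metric.closedBall x r)) {t : ℝ} (ht : r⁻¹ ≤ t) :
    ∫ z, w (x + z) * (t ^ n * meanKernel α (t • z)) =
      ∫ z, w (x + z) * ((r⁻¹) ^ n * meanKernel α (r⁻¹ • z)) := by
  have hr' := inv_pos.2 hr
  have ht0 : 0 < t := hr'.trans_le ht
  have hψ := continuous_bumpLaplacian (n := n) hn hα hα₂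
  have hψi := integrable_bumpLaplacian (n := n) hn hα hα₂
  have hM := integrable_meanKernel (n := n) hn hα hα₂
  have hi : ∀ t : ℝ, 0 < t → Integrable fun z =>
      w (x + z) * (t ^ n * meanKernel α (t • z)) := fun t ht =>
    hw.integrable_mul_shift x ((hM.comp_smul ht.ne').const_mul _)
  rw [← sub_eq_zero, ← integral_sub (hi t ht0) (hi _ hr')]
  have hint : ∀ (z : EuclideanSpace ℝ (Fin n)) (a b : ℝ), IntervalIntegrable
      (fun τ : ℝ => τ ^ (n - 1) * bumpLaplacian α (τ • z)) volume a b := fun z a b =>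
    Continuous.intervalIntegrable (by fun_prop) _ _
  have e : ∀ z, w (x + z) * (t ^ n * meanKernel α (t • z)) -
      w (x + z) * ((r⁻¹) ^ n * meanKernel α (r⁻¹ • z)) =
      ∫ τ in r⁻¹..t, w (x + z) * (τ ^ (n - 1) * bumpLaplacian α (τ • z)) := fun z => by
    rw [← mul_sub, pow_mul_meanKernel_smul hn, pow_mul_meanKernel_smul hn,
      intervalIntegral.integral_interval_sub_left (hint z _ _) (hint z _ _),
      intervalIntegral.integral_const_mul]
  simp only [e]
  have hcont : Continuous fun p : ℝ × EuclideanSpace ℝ (Fin n) =>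
      p.1 ^ (n - 1) * bumpLaplacian α (p.1 • p.2) := by fun_prop
  have hker : Integrable (fun p : ℝ × EuclideanSpace ℝ (Fin n) =>
      p.1 ^ (n - 1) * bumpLaplacian α (p.1 • p.2))
      ((volume.restrict (uIoc r⁻¹ t)).prod volume) := by
    refine (integrable_prod_iff hcont.aestronglyMeasurable).2 ⟨?_, ?_⟩
    · refine (ae_restrict_iff' measurableSet_uIoc).2 (ae_of_all _ fun τ hτ => ?_)
      rw [uIoc_of_le ht] at hτ
      exact (hψi.comp_smul (hr'.trans hτ.1).ne').const_mul (τ ^ (n - 1))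
    · have e3 : ∀ τ : ℝ, ∫ z, ‖τ ^ (n - 1) * bumpLaplacian α (τ • z)‖ =
          ‖τ ^ (n - 1)‖ * (|(τ ^ n)⁻¹| * ∫ z, ‖bumpLaplacian (n := n) α z‖) := fun τ => by
        simp only [norm_mul]
        rw [integral_const_mul, Measure.integral_comp_smul volume
          (fun z => ‖bumpLaplacian (n := n) α z‖), finrank_euclideanSpace, Fintype.card_fin,
          smul_eq_mul]
      simp only [e3]
      rw [uIoc_of_le ht]
      have : ContinuousOn (fun τ : ℝ => ‖τ ^ (n - 1)‖ *
          (|(τ ^ n)⁻¹| * ∫ z, ‖bumpLaplacian (n := n) α z‖)) (Icc r⁻¹ t) := by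
        have h1 : ContinuousOn (fun τ : ℝ => (τ ^ n)⁻¹) (Icc r⁻¹ t) :=
          (continuous_pow n).continuousOn.inv₀ fun τ hτ => (pow_pos (hr'.trans_le hτ.1) n).ne'
        fun_prop
      exact this.integrableOn_Icc.mono_set Ioc_subset_Icc_self
  have hprod : Integrable (Function.uncurry fun (τ : ℝ) (z : EuclideanSpace ℝ (Fin n)) =>
      w (x + z) * (τ ^ (n - 1) * bumpLaplacian α (τ • z)))
      ((volume.restrict (uIoc r⁻¹ t)).prod volume) :=
    hker.bdd_mul (c := B) (hw.aestronglyMeasurable.comp_measurePreserving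
      (measurePreserving_add_left volume x)).comp_snd (ae_of_all _ fun _ => hw.abs_le _)
  rw [← intervalIntegral_integral_swap hprod, intervalIntegral.integral_of_le ht]
  refine setIntegral_eq_zero_of_forall_eq_zero fun τ hτ => ?_
  simp only [mul_left_comm]
  rw [integral_const_mul, hw.integral_mul_bumpLaplacian hn hα hα₂ hr hτ.1.le, mul_zero]

/-- Bounded `α`-harmonic functions are reproduced by the averaging kernel. -/
theorem integral_mul_meanKernel (hn : 1 ≤ n) (hα : 0 < α) (hα₂ : α < 2)
    {x : EuclideanSpace ℝ (Fin n)} {r : ℝ} (hr : 0 < r)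
    (hw : IsBddHarmonicOn α B w (Metric.closedBall x r)) :
    ∫ z, w (x + z) * ((r⁻¹) ^ n * meanKernel α (r⁻¹ • z)) =
      w x * ∫ z : EuclideanSpace ℝ (Fin n), meanKernel α z := by
  have hM := integrable_meanKernel (n := n) hn hα hα₂
  -- As `t → ∞` the dilated kernel concentrates at `x`; continuity of `w` there is all that is
  -- needed.
  have hlim : Tendsto (fun t : ℝ => ∫ z, w (x + t⁻¹ • z) * meanKernel α z) atTop
      (𝓝 (∫ z : EuclideanSpace ℝ (Fin n), w x * meanKernel α z)) := by
    refine tendsto_integral_filter_of_dominated_convergence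
      (fun z => B * ‖meanKernel (n := n) α z‖) ?_ ?_ (hM.norm.const_mul B) ?_
    · filter_upwards [eventually_gt_atTop 0] with t ht
      exact ((hw.aestronglyMeasurable.comp_measurePreserving
        (measurePreserving_add_left volume x)).comp_quasiMeasurePreserving
        (Measure.quasiMeasurePreserving_smul volume (inv_pos.2 ht).ne')).mul hM.1
    · refine Eventually.of_forall fun t => ae_of_all _ fun z => ?_
      rw [norm_mul]
      exact mul_le_mul_of_nonneg_right (hw.abs_le _) (norm_nonneg _)
    · refine ae_of_all _ fun z => Tendsto.mul_const _ ?_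
      have h1 : Tendsto (fun t : ℝ => x + t⁻¹ • z) atTop (𝓝 x) := by
        have := (tendsto_const_nhds (x := x)).add
          ((tendsto_inv_atTop_zero (𝕜 := ℝ)).smul_const z)
        simpa using this
      exact (hw.continuousAt x (Metric.mem_closedBall_self hr.le)).tendsto.comp h1
  rw [integral_const_mul] at hlim
  refine tendsto_nhds_unique (tendsto_const_nhds.congr' ?_) hlim
  filter_upwards [eventually_ge_atTop r⁻¹] with t ht
  have ht0 : 0 < t := (inv_pos.2 hr).trans_le ht
  rw [← hw.integral_mul_meanKernel_eq hn hα hα₂ hr ht]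
  have := Measure.integral_comp_smul volume (fun z => w (x + t⁻¹ • z) * meanKernel α z) t
  simp only [inv_smul_smul₀ ht0.ne', finrank_euclideanSpace, Fintype.card_fin, smul_eq_mul,
    abs_of_pos (inv_pos.2 (pow_pos ht0 n))] at this
  simp only [mul_left_comm _ (t ^ n)]
  rw [integral_const_mul, this, mul_inv_cancel_left₀ (pow_pos ht0 n).ne']

end IsBddHarmonicOn

/-- Interior estimate: a bounded `α`-harmonic function coincides locally with a function whose
iterated differences are controlled by the supremum of the function. -/
theorem exists_interior_estimate {n : ℕ} {α : ℝ} (hn : 1 ≤ n) (hα : 0 < α) (hα₂ : α < 2)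
    {r : ℝ} (hr : 0 < r) {m : ℕ} (hm : 1 ≤ m) :
    ∃ C : ℝ, 0 ≤ C ∧ ∀ (B : ℝ) (w : EuclideanSpace ℝ (Fin n) → ℝ),
      AEStronglyMeasurable w volume → (∀ x, |w x| ≤ B) →
      ∃ W : EuclideanSpace ℝ (Fin n) → ℝ,
        (∀ x, IsBddHarmonicOn α B w (Metric.closedBall x r) → w x = W x) ∧
        ∀ l : List (EuclideanSpace ℝ (Fin n)), l.length = m → (∀ h ∈ l, ‖h‖ ≤ r) → ∀ x,
          |iterDiff l W x| ≤ C * B * (l.map norm).prod := by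
  obtain ⟨C, hC0, hC⟩ := exists_integral_abs_iterDiff_meanKernel_le (n := n) hn hα hα₂ hm
  have hM := integrable_meanKernel (n := n) hn hα hα₂
  have hκ := integral_meanKernel_pos (n := n) hn hα hα₂
  set κ := ∫ x : EuclideanSpace ℝ (Fin n), meanKernel α x with hκdef
  have hr' := inv_pos.2 hr
  -- `κ⁻¹` normalizes the kernel, and `(r⁻¹)^m` comes from rescaling the `m` steps.
  refine ⟨κ⁻¹ * (C * (r⁻¹) ^ m), by positivity, fun B w hwm hB => ?_⟩
  have hB0 : 0 ≤ B := (abs_nonneg _).trans (hB 0)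
  have hi : ∀ x, Integrable fun z => w z * meanKernel α (r⁻¹ • (x - z)) := fun x =>
    ((hM.comp_smul hr'.ne').comp_sub_left x).bdd_mul hwm (ae_of_all _ hB)
  -- `W` is the convolution of `w` with the normalized kernel at scale `r`. It is defined
  -- everywhere, so its differences are estimated with no restriction on `x`.
  refine ⟨fun x => κ⁻¹ * (r⁻¹) ^ n * ∫ z, w z * meanKernel α (r⁻¹ • (x - z)), fun x hx => ?_,
    fun l hl hl1 x => ?_⟩
  · have h1 := hx.integral_mul_meanKernel hn hα hα₂ hr
    rw [← integral_sub_right_eq_self _ x] at h1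
    have e : ∀ z, w (x + (z - x)) * ((r⁻¹) ^ n * meanKernel α (r⁻¹ • (z - x))) =
        (r⁻¹) ^ n * (w z * meanKernel α (r⁻¹ • (x - z))) := fun z => by
      rw [add_sub_cancel, meanKernel_congr (x := r⁻¹ • (z - x)) (y := r⁻¹ • (x - z))
        (by rw [norm_smul, norm_smul, norm_sub_rev])]
      ring
    simp only [e] at h1
    rw [integral_const_mul] at h1
    simp only [mul_assoc]
    rw [h1, ← hκdef]
    field_simp
  · obtain ⟨j1, j2⟩ := hC (l.map (r⁻¹ • ·)) (by simp [hl])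
      (norm_le_one_of_mem_map_smul hr' (by simpa using hl1))
    have e : ∀ z, iterDiff l (fun y => w z * meanKernel α (r⁻¹ • (y - z))) x =
        w z * iterDiff (l.map (r⁻¹ • ·)) (meanKernel α) (r⁻¹ • (x - z)) := fun z => by
      have h3 := iterDiff_congr_shift l (fun y => meanKernel (n := n) α (r⁻¹ • y)) (-z) x
      simp only [← sub_eq_add_neg] at h3
      rw [iterDiff_const_mul, h3, iterDiff_comp_smul]
    rw [iterDiff_const_mul, (iterDiff_integral l _ hi x).1]
    simp only [e]
    set D := iterDiff (l.map (r⁻¹ • ·)) (meanKernel (n := n) α) with hD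
    have i1 : Integrable fun z => D (r⁻¹ • (x - z)) := (j1.comp_smul hr'.ne').comp_sub_left x
    have h4 : |∫ z, w z * D (r⁻¹ • (x - z))| ≤ B * ∫ z, |D (r⁻¹ • (x - z))| := by
      rw [← integral_const_mul, ← Real.norm_eq_abs]
      refine norm_integral_le_of_norm_le (i1.abs.const_mul B) (ae_of_all _ fun z => ?_)
      rw [norm_mul]
      exact mul_le_mul_of_nonneg_right (hB z) (norm_nonneg _)
    have h5 : ∫ z, |D (r⁻¹ • (x - z))| = ((r⁻¹) ^ n)⁻¹ * ∫ z, |D z| := by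
      rw [integral_sub_left_eq_self (fun z => |D (r⁻¹ • z)|) volume x,
        Measure.integral_comp_smul volume (fun z => |D z|), finrank_euclideanSpace,
        Fintype.card_fin, abs_of_pos (inv_pos.2 (pow_pos hr' n)), smul_eq_mul]
    rw [prod_map_norm_smul hr'.le, hl] at j2
    rw [abs_mul, abs_of_pos (by positivity)]
    calc κ⁻¹ * (r⁻¹) ^ n * |∫ z, w z * D (r⁻¹ • (x - z))|
        ≤ κ⁻¹ * (r⁻¹) ^ n * (B * (((r⁻¹) ^ n)⁻¹ * (C * ((r⁻¹) ^ m * (l.map norm).prod)))) := by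
          refine mul_le_mul_of_nonneg_left (h4.trans (mul_le_mul_of_nonneg_left ?_ hB0))
            (by positivity)
          rw [h5]
          exact mul_le_mul_of_nonneg_left j2 (by positivity)
      _ = _ := by
        have : (r⁻¹) ^ n * ((r⁻¹) ^ n)⁻¹ = 1 := mul_inv_cancel₀ (pow_pos hr' n).ne'
        linear_combination (κ⁻¹ * B * C * (r⁻¹) ^ m * (l.map norm).prod) * this

/-! ### The principal value versus the symmetrized integral. -/

section FracLaplacian

variable {n : ℕ} {α : ℝ}

theorem fracLaplacianConst_pos (hα : 0 < α) (hα₂ : α < 2) : 0 < fracLaplacianConst n α := by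
  have h1 : 0 < Real.Gamma (((n : ℝ) + α) / 2) := Real.Gamma_pos_of_pos (by positivity)
  have h2 : 0 < Real.Gamma (1 - α / 2) := Real.Gamma_pos_of_pos (by linarith)
  have h3 := Real.pi_pos
  unfold fracLaplacianConst
  positivity

theorem HasFracLaplacianAt.sub {u v : EuclideanSpace ℝ (Fin n) → ℝ}
    {x : EuclideanSpace ℝ (Fin n)} {a b : ℝ} (hu : HasFracLaplacianAt α u x a)
    (hv : HasFracLaplacianAt α v x b) : HasFracLaplacianAt α (fun y => u y - v y) x (a - b) := by
  have e : fracLaplacianIntegrand α (fun y => u y - v y) x =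
      fun y => fracLaplacianIntegrand α u x y - fracLaplacianIntegrand α v x y := by
    funext y; simp only [fracLaplacianIntegrand]; ring
  refine ⟨fun ε hε => by rw [e]; exact (hu.1 ε hε).sub (hv.1 ε hε), ?_⟩
  refine (hu.2.sub hv.2).congr' ?_
  filter_upwards [self_mem_nhdsWithin] with ε hε
  rw [e, integral_sub (hu.1 ε hε) (hv.1 ε hε), mul_sub]

theorem HasFracLaplacianAt.add {u v : EuclideanSpace ℝ (Fin n) → ℝ}
    {x : EuclideanSpace ℝ (Fin n)} {a b : ℝ} (hu : HasFracLaplacianAt α u x a)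
    (hv : HasFracLaplacianAt α v x b) : HasFracLaplacianAt α (fun y => u y + v y) x (a + b) := by
  have e : fracLaplacianIntegrand α (fun y => u y + v y) x =
      fun y => fracLaplacianIntegrand α u x y + fracLaplacianIntegrand α v x y := by
    funext y; simp only [fracLaplacianIntegrand]; ring
  refine ⟨fun ε hε => by rw [e]; exact (hu.1 ε hε).add (hv.1 ε hε), ?_⟩
  refine (hu.2.add hv.2).congr' ?_
  filter_upwards [self_mem_nhdsWithin] with ε hε
  rw [e, integral_add (hu.1 ε hε) (hv.1 ε hε), mul_add]

theorem integrable_indicator_fracKernel (hn : 1 ≤ n) (hα : 0 < α) {ε : ℝ} (hε : 0 < ε) :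
    Integrable ({h : EuclideanSpace ℝ (Fin n) | ε ≤ ‖h‖}.indicator (fracKernel α)) :=
  (integrable_indicator_iff (measurableSet_le_norm ε)).2 (integrableOn_fracKernel hn hα hε)

theorem indicator_fracLaplacianIntegrand (w : EuclideanSpace ℝ (Fin n) → ℝ)
    (x y : EuclideanSpace ℝ (Fin n)) (ε : ℝ) :
    {y | ε ≤ ‖y - x‖}.indicator (fracLaplacianIntegrand α w x) y =
      (w x - w y) * {h | ε ≤ ‖h‖}.indicator (fracKernel α) (x - y) := by
  by_cases h : ε ≤ ‖y - x‖
  · rw [indicator_of_mem (by exact h),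
      indicator_of_mem (show x - y ∈ {h | ε ≤ ‖h‖} by rwa [mem_ofPred_eq, norm_sub_rev])]
    rfl
  · rw [indicator_of_notMem (by exact h),
      indicator_of_notMem (show x - y ∉ {h | ε ≤ ‖h‖} by rwa [mem_ofPred_eq, norm_sub_rev]),
      mul_zero]

theorem measurableSet_le_norm_sub (ε : ℝ) (x : EuclideanSpace ℝ (Fin n)) :
    MeasurableSet {y : EuclideanSpace ℝ (Fin n) | ε ≤ ‖y - x‖} :=
  (isClosed_le continuous_const (by fun_prop)).measurableSet

theorem integrableOn_fracLaplacianIntegrand (hn : 1 ≤ n) (hα : 0 < α)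
    {w : EuclideanSpace ℝ (Fin n) → ℝ} (hw : AEStronglyMeasurable w volume) {B : ℝ}
    (hB : ∀ x, |w x| ≤ B) (x : EuclideanSpace ℝ (Fin n)) {ε : ℝ} (hε : 0 < ε) :
    IntegrableOn (fracLaplacianIntegrand α w x) {y | ε ≤ ‖y - x‖} := by
  rw [← integrable_indicator_iff (measurableSet_le_norm_sub ε x),
    show {y | ε ≤ ‖y - x‖}.indicator (fracLaplacianIntegrand α w x) = _ from
      funext fun y => indicator_fracLaplacianIntegrand w x y ε]
  refine ((integrable_indicator_fracKernel hn hα hε).comp_sub_left x).bdd_mul (c := B + B)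
    (aestronglyMeasurable_const.sub hw) (ae_of_all _ fun y => ?_)
  exact (norm_sub_le _ _).trans (add_le_add (hB x) (hB y))

/-- Average the parametrizations `y = x + h` and `y = x - h`; the truncated region and the kernel
are even in `h`. -/
theorem setIntegral_fracLaplacianIntegrand (hn : 1 ≤ n) (hα : 0 < α)
    {w : EuclideanSpace ℝ (Fin n) → ℝ} (hw : AEStronglyMeasurable w volume) {B : ℝ}
    (hB : ∀ x, |w x| ≤ B) (x : EuclideanSpace ℝ (Fin n)) {ε : ℝ} (hε : 0 < ε) :
    ∫ y in {y | ε ≤ ‖y - x‖}, fracLaplacianIntegrand α w x y =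
      2⁻¹ * ∫ h in {h | ε ≤ ‖h‖}, secondDiff w x h * fracKernel α h := by
  have hi := integrableOn_fracLaplacianIntegrand hn hα hw hB x hε
  rw [← integrable_indicator_iff (measurableSet_le_norm_sub ε x)] at hi
  rw [← integral_indicator (measurableSet_le_norm_sub ε x),
    ← integral_indicator (measurableSet_le_norm ε)]
  set F := {y | ε ≤ ‖y - x‖}.indicator (fracLaplacianIntegrand α w x) with hF
  have e : ∀ h, {h | ε ≤ ‖h‖}.indicator (fun h => secondDiff w x h * fracKernel α h) h =
      F (x + h) + F (x - h) := fun h => by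
    rw [hF, indicator_fracLaplacianIntegrand, indicator_fracLaplacianIntegrand, sub_sub_cancel,
      sub_add_cancel_left]
    by_cases hh : ε ≤ ‖h‖
    · rw [indicator_of_mem (a := h) (by exact hh), indicator_of_mem (a := h) (by exact hh),
        indicator_of_mem (show -h ∈ {h | ε ≤ ‖h‖} by rwa [mem_ofPred_eq, norm_neg]),
        fracKernel_neg, secondDiff]
      ring
    · rw [indicator_of_notMem (a := h) (by exact hh), indicator_of_notMem (a := h) (by exact hh),
        indicator_of_notMem (show -h ∉ {h | ε ≤ ‖h‖} by rwa [mem_ofPred_eq, norm_neg])]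
      simp
  simp only [e]
  rw [integral_add (hi.comp_add_left x) (hi.comp_sub_left x), integral_add_left_eq_self F x,
    integral_sub_left_eq_self F volume x]
  ring

/-- Second differences of order `s > α` make the symmetrized integral absolutely convergent, so the
principal value exists and is a positive multiple of it. -/
theorem hasFracLaplacianAt_zero_iff (hn : 1 ≤ n) (hα : 0 < α) (hα₂ : α < 2)
    {w : EuclideanSpace ℝ (Fin n) → ℝ} (hw : AEStronglyMeasurable w volume) {B : ℝ}
    (hB : ∀ x, |w x| ≤ B) {x : EuclideanSpace ℝ (Fin n)} {s C : ℝ} (hs : α < s)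
    (hC : ∀ h, |secondDiff w x h| ≤ C * min 1 (‖h‖ ^ s)) :
    HasFracLaplacianAt α w x 0 ↔ symmLaplacian α w x = 0 := by
  have hlim := tendsto_setIntegral_le_norm hn
    (integrable_secondDiff_mul_fracKernel hn hα hw hs hC)
  have hlim' : Tendsto (fun ε : ℝ => fracLaplacianConst n α *
      ∫ y in {y | ε ≤ ‖y - x‖}, fracLaplacianIntegrand α w x y) (𝓝[>] 0)
      (𝓝 (fracLaplacianConst n α * (2⁻¹ * symmLaplacian α w x))) := by
    refine ((hlim.const_mul 2⁻¹).const_mul (fracLaplacianConst n α)).congr' ?_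
    filter_upwards [self_mem_nhdsWithin] with ε hε
    rw [setIntegral_fracLaplacianIntegrand hn hα hw hB x hε]
  constructor
  · intro h
    have := tendsto_nhds_unique hlim' h.2
    simpa [(fracLaplacianConst_pos hα hα₂).ne'] using this
  · intro h
    refine ⟨fun ε hε => integrableOn_fracLaplacianIntegrand hn hα hw hB x hε, ?_⟩
    rwa [h, mul_zero, mul_zero] at hlim'

end FracLaplacian

/-! ### Second differences from Hölder regularity. -/

section Holder

variable {n : ℕ} {α : ℝ}

theorem dist_iteratedFDeriv_zero {F : Type*} [NormedAddCommGroup F] [NormedSpace ℝ F]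
    (u : EuclideanSpace ℝ (Fin n) → F)
    (x y : EuclideanSpace ℝ (Fin n)) :
    dist (iteratedFDeriv ℝ 0 u x) (iteratedFDeriv ℝ 0 u y) = dist (u x) (u y) := by
  simp only [iteratedFDeriv_zero_eq_comp, Function.comp_apply, LinearIsometryEquiv.dist_map]

theorem dist_iteratedFDeriv_one (u : EuclideanSpace ℝ (Fin n) → ℝ)
    (x y : EuclideanSpace ℝ (Fin n)) :
    dist (iteratedFDeriv ℝ 1 u x) (iteratedFDeriv ℝ 1 u y) = dist (fderiv ℝ u x) (fderiv ℝ u y) := by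
  rw [iteratedFDeriv_succ_eq_comp_right, iteratedFDeriv_succ_eq_comp_right, Function.comp_apply,
    Function.comp_apply, LinearIsometryEquiv.dist_map, dist_iteratedFDeriv_zero]

theorem abs_secondDiff_le_of_holder {u : EuclideanSpace ℝ (Fin n) → ℝ}
    {β C : NNReal} {U : Set (EuclideanSpace ℝ (Fin n))}
    (hU : HolderOnWith C β (iteratedFDeriv ℝ 0 u) U) {z h : EuclideanSpace ℝ (Fin n)}
    (hz : z ∈ U) (hz1 : z + h ∈ U) (hz2 : z - h ∈ U) :
    |secondDiff u z h| ≤ 2 * C * ‖h‖ ^ (β : ℝ) := by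
  have h1 := hU.dist_le hz hz1
  have h2 := hU.dist_le hz hz2
  rw [dist_iteratedFDeriv_zero, dist_self_add_right, Real.dist_eq] at h1
  rw [dist_iteratedFDeriv_zero, dist_eq_norm z, sub_sub_cancel, Real.dist_eq] at h2
  have : secondDiff u z h = (u z - u (z + h)) + (u z - u (z - h)) := by rw [secondDiff]; ring
  rw [this]
  linarith [abs_add_le (u z - u (z + h)) (u z - u (z - h))]

/-- Apply the mean value inequality to `t ↦ u(z+th) + u(z-th)` on `[0,1]`: its derivative compares
gradients at points at most `2‖h‖` apart. -/
theorem abs_secondDiff_le_of_fderiv_holder {u : EuclideanSpace ℝ (Fin n) → ℝ}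
    {β C : NNReal} {x : EuclideanSpace ℝ (Fin n)} {r : ℝ}
    (hd : ∀ y ∈ Metric.ball x r, DifferentiableAt ℝ u y)
    (hU : HolderOnWith C β (iteratedFDeriv ℝ 1 u) (Metric.ball x r))
    {z h : EuclideanSpace ℝ (Fin n)} (hz : ‖z - x‖ + ‖h‖ < r) :
    |secondDiff u z h| ≤ C * 2 ^ (β : ℝ) * ‖h‖ ^ (1 + (β : ℝ)) := by
  have mem : ∀ c : ℝ, |c| ≤ 1 → z + c • h ∈ Metric.ball x r := fun c hc => by
    rw [Metric.mem_ball, dist_eq_norm, add_sub_right_comm]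
    calc ‖z - x + c • h‖ ≤ ‖z - x‖ + |c| * ‖h‖ := by
          simpa [norm_smul] using norm_add_le (z - x) (c • h)
      _ ≤ ‖z - x‖ + 1 * ‖h‖ := by gcongr
      _ < r := by linarith
  have hder : ∀ t ∈ Icc (0 : ℝ) 1, HasDerivWithinAt
      (fun t : ℝ => u (z + t • h) + u (z + (-t) • h))
      (fderiv ℝ u (z + t • h) h - fderiv ℝ u (z + (-t) • h) h) (Icc 0 1) t := fun t ht => by
    have ht1 : |t| ≤ 1 := abs_le.2 ⟨by linarith [ht.1], ht.2⟩
    have d1 : HasDerivAt (fun t : ℝ => z + t • h) h t := by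
      simpa using ((hasDerivAt_id t).smul_const h).const_add z
    have d2 : HasDerivAt (fun t : ℝ => z + (-t) • h) (-h) t := by
      simpa using ((hasDerivAt_neg t).smul_const h).const_add z
    have f1 := (hd _ (mem t ht1)).hasFDerivAt.comp_hasDerivAt t d1
    have f2 := (hd _ (mem (-t) (by rwa [abs_neg]))).hasFDerivAt.comp_hasDerivAt t d2
    rw [map_neg] at f2
    rw [sub_eq_add_neg]
    exact (f1.add f2).hasDerivWithinAt
  have hbd : ∀ t ∈ Ico (0 : ℝ) 1, ‖fderiv ℝ u (z + t • h) h - fderiv ℝ u (z + (-t) • h) h‖ ≤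
      C * 2 ^ (β : ℝ) * ‖h‖ ^ (1 + (β : ℝ)) := fun t ht => by
    have ht1 : |t| ≤ 1 := abs_le.2 ⟨by linarith [ht.1], ht.2.le⟩
    have h1 := hU.dist_le (mem t ht1) (mem (-t) (by rwa [abs_neg]))
    have h2 : dist (z + t • h) (z + (-t) • h) ≤ 2 * ‖h‖ := by
      rw [dist_eq_norm, add_sub_add_left_eq_sub, ← sub_smul, norm_smul, Real.norm_eq_abs,
        abs_of_nonneg (by linarith [ht.1])]
      exact mul_le_mul_of_nonneg_right (by linarith [ht.2]) (norm_nonneg h)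
    rw [dist_iteratedFDeriv_one, dist_eq_norm] at h1
    rw [← sub_apply]
    calc _ ≤ ‖fderiv ℝ u (z + t • h) - fderiv ℝ u (z + (-t) • h)‖ * ‖h‖ :=
          ContinuousLinearMap.le_opNorm _ _
      _ ≤ C * (2 * ‖h‖) ^ (β : ℝ) * ‖h‖ := by
          gcongr
          exact h1.trans (by gcongr)
      _ = _ := by
          rw [Real.mul_rpow two_pos.le (norm_nonneg h), add_comm,
            Real.rpow_add_one' (norm_nonneg h) (by positivity)]
          ring
  have := norm_image_sub_le_of_norm_deriv_le_segment_01' hder hbd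
  rw [← abs_neg]
  convert this using 1
  simp only [secondDiff, neg_smul, one_smul, zero_smul, neg_zero, add_zero, Real.norm_eq_abs,
    ← sub_eq_add_neg]
  congr 1; ring

theorem natFloor_eq_zero_or_one (hα : 0 < α) (hα₂ : α < 2) :
    (⌊α⌋₊ = 0 ∧ Int.fract α = α) ∨ (⌊α⌋₊ = 1 ∧ Int.fract α = α - 1) := by
  rcases lt_or_ge α 1 with h | h
  · exact Or.inl ⟨Nat.floor_eq_zero.2 h, Int.fract_eq_self.2 ⟨hα.le, h⟩⟩
  · have h1 : ⌊α⌋ = 1 := Int.floor_eq_iff.2 ⟨by simpa using h, by norm_num; linarith⟩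
    refine Or.inr ⟨(Nat.floor_eq_iff hα.le).2 ⟨by simpa using h, by norm_num; linarith⟩, ?_⟩
    rw [Int.fract, h1, Int.cast_one]

/-- The exponent is `β` for `α < 1` and `1 + β` for `α ≥ 1`; both exceed `α` because `β` exceeds the
fractional part. -/
theorem IsHolderLocAbove.exists_secondDiff_le {u : EuclideanSpace ℝ (Fin n) → ℝ}
    {Ω : Set (EuclideanSpace ℝ (Fin n))} (hu : IsHolderLocAbove α u Ω) (hΩ : IsOpen Ω)
    (hα : 0 < α) (hα₂ : α < 2) :
    ∃ s : ℝ, α < s ∧ ∀ x ∈ Ω, ∃ C δ : ℝ, 0 ≤ C ∧ 0 < δ ∧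
      ∀ z ∈ Metric.ball x δ, ∀ h, ‖h‖ < δ → |secondDiff u z h| ≤ C * ‖h‖ ^ s := by
  obtain ⟨β, hβ, -, hd, hH⟩ := hu
  rcases natFloor_eq_zero_or_one hα hα₂ with ⟨h1, h2⟩ | ⟨h1, h2⟩
  · refine ⟨β, h2 ▸ hβ, fun x hx => ?_⟩
    obtain ⟨C, U, hU, hC⟩ := hH x hx
    rw [h1] at hC
    obtain ⟨r, hr, hrU⟩ := Metric.mem_nhds_iff.1 hU
    refine ⟨2 * C, r / 2, by positivity, by positivity, fun z hz h hh => ?_⟩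
    rw [Metric.mem_ball, dist_eq_norm] at hz
    refine abs_secondDiff_le_of_holder hC (hrU ?_) (hrU ?_) (hrU ?_) <;>
      rw [Metric.mem_ball, dist_eq_norm]
    · linarith
    · rw [add_sub_right_comm]; linarith [norm_add_le (z - x) h]
    · rw [sub_right_comm]; linarith [norm_sub_le (z - x) h]
  · refine ⟨1 + β, by linarith, fun x hx => ?_⟩
    obtain ⟨C, U, hU, hC⟩ := hH x hx
    rw [h1] at hC hd
    obtain ⟨r, hr, hrU⟩ := Metric.mem_nhds_iff.1 (inter_mem hU (hΩ.mem_nhds hx))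
    refine ⟨C * 2 ^ (β : ℝ), r / 2, by positivity, by positivity, fun z hz h hh => ?_⟩
    rw [Metric.mem_ball, dist_eq_norm] at hz
    exact abs_secondDiff_le_of_fderiv_holder
      (fun y hy => (hd.differentiableOn (by simp)).differentiableAt (hΩ.mem_nhds (hrU hy).2))
      (hC.mono fun y hy => (hrU hy).1) (by linarith)

theorem IsHolderLocAbove.exists_secondDiff_le_of_isCompact {u : EuclideanSpace ℝ (Fin n) → ℝ}
    {Ω : Set (EuclideanSpace ℝ (Fin n))} (hu : IsHolderLocAbove α u Ω) (hΩ : IsOpen Ω)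
    (hα : 0 < α) (hα₂ : α < 2) {S : Set (EuclideanSpace ℝ (Fin n))} (hS : IsCompact S)
    (hSΩ : S ⊆ Ω) :
    ∃ s C δ : ℝ, α < s ∧ 0 ≤ C ∧ 0 < δ ∧
      ∀ z ∈ S, ∀ h, ‖h‖ < δ → |secondDiff u z h| ≤ C * ‖h‖ ^ s := by
  obtain ⟨s, hs, h⟩ := hu.exists_secondDiff_le hΩ hα hα₂
  have : ∃ C δ : ℝ, 0 ≤ C ∧ 0 < δ ∧
      ∀ z ∈ S, ∀ h, ‖h‖ < δ → |secondDiff u z h| ≤ C * ‖h‖ ^ s := by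
    refine hS.induction_on (p := fun S => ∃ C δ : ℝ, 0 ≤ C ∧ 0 < δ ∧
      ∀ z ∈ S, ∀ h, ‖h‖ < δ → |secondDiff u z h| ≤ C * ‖h‖ ^ s) ?_ ?_ ?_ ?_
    · exact ⟨0, 1, le_rfl, one_pos, fun z hz => hz.elim⟩
    · rintro A A' hAA ⟨C, δ, hC, hδ, hz⟩
      exact ⟨C, δ, hC, hδ, fun z hzA => hz z (hAA hzA)⟩
    · rintro A A' ⟨C, δ, hC, hδ, hz⟩ ⟨C', δ', hC', hδ', hz'⟩
      refine ⟨max C C', min δ δ', le_max_of_le_left hC, lt_min hδ hδ', fun z hzA h hh => ?_⟩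
      have hp : 0 ≤ ‖h‖ ^ s := by positivity
      rcases hzA with hzA | hzA
      · exact (hz z hzA h (hh.trans_le (min_le_left _ _))).trans
          (mul_le_mul_of_nonneg_right (le_max_left _ _) hp)
      · exact (hz' z hzA h (hh.trans_le (min_le_right _ _))).trans
          (mul_le_mul_of_nonneg_right (le_max_right _ _) hp)
    · intro x hx
      obtain ⟨C, δ, hC, hδ, hz⟩ := h x (hSΩ hx)
      exact ⟨Metric.ball x δ, mem_nhdsWithin_of_mem_nhds (Metric.ball_mem_nhds x hδ), C, δ, hC, hδ,
        hz⟩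
  obtain ⟨C, δ, h1, h2, h3⟩ := this
  exact ⟨s, C, δ, hs, h1, h2, h3⟩

theorem abs_secondDiff_le_of_abs_le {w : EuclideanSpace ℝ (Fin n) → ℝ} {B : ℝ}
    (hB : ∀ x, |w x| ≤ B) (x h : EuclideanSpace ℝ (Fin n)) : |secondDiff w x h| ≤ 4 * B := by
  have a := abs_le.1 (hB x)
  have b := abs_le.1 (hB (x + h))
  have c := abs_le.1 (hB (x - h))
  rw [secondDiff]
  exact abs_le.2 ⟨by linarith, by linarith⟩

theorem abs_secondDiff_le_min_of_local {w : EuclideanSpace ℝ (Fin n) → ℝ} {B : ℝ}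
    (hB : ∀ x, |w x| ≤ B) {x : EuclideanSpace ℝ (Fin n)} {s C δ : ℝ} (hs : 0 < s) (hC : 0 ≤ C)
    (hδ : 0 < δ) (hδ1 : δ ≤ 1) (hx : ∀ h, ‖h‖ < δ → |secondDiff w x h| ≤ C * ‖h‖ ^ s)
    (h : EuclideanSpace ℝ (Fin n)) :
    |secondDiff w x h| ≤ (C + 4 * B / δ ^ s) * min 1 (‖h‖ ^ s) := by
  have hB0 : 0 ≤ B := (abs_nonneg _).trans (hB x)
  have hds : 0 < δ ^ s := by positivity
  rcases lt_or_ge ‖h‖ δ with h1 | h1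
  · rw [min_eq_right (Real.rpow_le_one (norm_nonneg h) (h1.le.trans hδ1) hs.le)]
    refine (hx h h1).trans (mul_le_mul_of_nonneg_right ?_ (by positivity))
    exact le_add_of_nonneg_right (by positivity)
  · have h2 : δ ^ s ≤ min 1 (‖h‖ ^ s) :=
      le_min (Real.rpow_le_one hδ.le hδ1 hs.le) (Real.rpow_le_rpow hδ.le h1 hs.le)
    calc |secondDiff w x h| ≤ 4 * B := abs_secondDiff_le_of_abs_le hB x h
      _ = 4 * B / δ ^ s * δ ^ s := by field_simp
      _ ≤ 4 * B / δ ^ s * min 1 (‖h‖ ^ s) := by gcongr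
      _ ≤ _ := mul_le_mul_of_nonneg_right (le_add_of_nonneg_left hC)
          (le_min zero_le_one (by positivity))

theorem IsHolderLocAbove.continuousAt {u : EuclideanSpace ℝ (Fin n) → ℝ}
    {Ω : Set (EuclideanSpace ℝ (Fin n))} (hu : IsHolderLocAbove α u Ω) (hΩ : IsOpen Ω)
    {x : EuclideanSpace ℝ (Fin n)} (hx : x ∈ Ω) : ContinuousAt u x := by
  obtain ⟨β, -, -, hd, -⟩ := hu
  exact hd.continuousOn.continuousAt (hΩ.mem_nhds hx)

/-- The two functions may have different exponents; for steps of length at most 1 the smaller one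
serves both. Large steps are handled by the sup bound on the difference. -/
theorem IsAlphaHarmonicOn.isBddHarmonicOn_sub (hn : 1 ≤ n) (hα : 0 < α) (hα₂ : α < 2)
    {u u' : EuclideanSpace ℝ (Fin n) → ℝ} {Ω : Set (EuclideanSpace ℝ (Fin n))} (hΩ : IsOpen Ω)
    (hu : IsAlphaHarmonicOn α u Ω) (hu' : IsAlphaHarmonicOn α u' Ω) {B : ℝ}
    (hB : ∀ x, |u x - u' x| ≤ B) {S : Set (EuclideanSpace ℝ (Fin n))} (hS : IsCompact S)
    (hSΩ : S ⊆ Ω) : IsBddHarmonicOn α B (fun x => u x - u' x) S := by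
  obtain ⟨s, C, δ, hs, hC, hδ, h⟩ :=
    hu.holder.exists_secondDiff_le_of_isCompact hΩ hα hα₂ hS hSΩ
  obtain ⟨s', C', δ', hs', hC', hδ', h'⟩ :=
    hu'.holder.exists_secondDiff_le_of_isCompact hΩ hα hα₂ hS hSΩ
  have hm : AEStronglyMeasurable (fun x => u x - u' x) volume :=
    hu.memWeightedL1.1.sub hu'.memWeightedL1.1
  have hss : α < min s s' := lt_min hs hs'
  have hB0 : 0 ≤ B := (abs_nonneg _).trans (hB 0)
  have hd0 : 0 < min 1 (min δ δ') := lt_min one_pos (lt_min hδ hδ')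
  have key : ∀ z ∈ S, ∀ h, |secondDiff (fun x => u x - u' x) z h| ≤
      (C + C' + 4 * B / min 1 (min δ δ') ^ min s s') * min 1 (‖h‖ ^ min s s') := by
    intro z hz
    refine abs_secondDiff_le_min_of_local hB (hα.trans hss) (by positivity)
      hd0 (min_le_left _ _) fun k hk => ?_
    have k1 : ‖k‖ ≤ 1 := hk.le.trans (min_le_left _ _)
    have k2 : ‖k‖ < δ := hk.trans_le ((min_le_right _ _).trans (min_le_left _ _))
    have k3 : ‖k‖ < δ' := hk.trans_le ((min_le_right _ _).trans (min_le_right _ _))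
    have e : secondDiff (fun x => u x - u' x) z k = secondDiff u z k - secondDiff u' z k := by
      simp only [secondDiff]; ring
    have p1 : ‖k‖ ^ s ≤ ‖k‖ ^ min s s' :=
      Real.rpow_le_rpow_of_exponent_ge' (norm_nonneg k) k1 (hα.trans hss).le (min_le_left _ _)
    have p2 : ‖k‖ ^ s' ≤ ‖k‖ ^ min s s' :=
      Real.rpow_le_rpow_of_exponent_ge' (norm_nonneg k) k1 (hα.trans hss).le (min_le_right _ _)
    rw [e, add_mul]
    exact (abs_sub _ _).trans (add_le_add
      ((h z hz k k2).trans (mul_le_mul_of_nonneg_left p1 hC))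
      ((h' z hz k k3).trans (mul_le_mul_of_nonneg_left p2 hC')))
  refine ⟨hm, hB, fun x hx => (hu.holder.continuousAt hΩ (hSΩ hx)).sub
    (hu'.holder.continuousAt hΩ (hSΩ hx)), ⟨min s s', _, hss, by positivity, key⟩, fun x hx => ?_⟩
  refine (hasFracLaplacianAt_zero_iff hn hα hα₂ hm hB hss (key x hx)).1 ?_
  have := (hu.fracLaplacian_eq_zero x (hSΩ hx)).sub (hu'.fracLaplacian_eq_zero x (hSΩ hx))
  rwa [sub_zero] at this

theorem integrable_inv_one_add_norm_rpow (hα : 0 < α) :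
    Integrable fun x : EuclideanSpace ℝ (Fin n) => 1 / (1 + ‖x‖ ^ ((n : ℝ) + α)) := by
  have hp : 0 < (n : ℝ) + α := by positivity
  have h1 := (integrable_one_add_norm (μ := (volume : Measure (EuclideanSpace ℝ (Fin n))))
    (r := (n : ℝ) + α) (by simpa using hα)).const_mul (2 ^ ((n : ℝ) + α))
  refine h1.mono' (Measurable.aestronglyMeasurable (by fun_prop)) (ae_of_all _ fun x => ?_)
  rw [Real.norm_of_nonneg (by positivity), Real.rpow_neg (by positivity), ← div_eq_mul_inv,
    div_le_div_iff₀ (by positivity) (by positivity), one_mul]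
  rcases le_total ‖x‖ 1 with h | h
  · calc (1 + ‖x‖) ^ ((n : ℝ) + α) ≤ 2 ^ ((n : ℝ) + α) :=
          Real.rpow_le_rpow (by positivity) (by linarith) hp.le
      _ ≤ _ := le_mul_of_one_le_right (by positivity) (by
          have : 0 ≤ ‖x‖ ^ ((n : ℝ) + α) := by positivity
          linarith)
  · calc (1 + ‖x‖) ^ ((n : ℝ) + α) ≤ (2 * ‖x‖) ^ ((n : ℝ) + α) :=
          Real.rpow_le_rpow (by positivity) (by linarith) hp.le
      _ = 2 ^ ((n : ℝ) + α) * ‖x‖ ^ ((n : ℝ) + α) := Real.mul_rpow two_pos.le (norm_nonneg x)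
      _ ≤ _ := mul_le_mul_of_nonneg_left (by linarith) (by positivity)

theorem MemWeightedL1.of_abs_sub_le (hα : 0 < α) {u v : EuclideanSpace ℝ (Fin n) → ℝ}
    (hu : MemWeightedL1 α u) (hv : AEStronglyMeasurable v volume) {B : ℝ}
    (hB : ∀ x, |v x - u x| ≤ B) : MemWeightedL1 α v := by
  refine ⟨hv, (hu.2.add ((integrable_inv_one_add_norm_rpow hα).const_mul B)).mono'
    (hv.norm.mul (by fun_prop : Measurable fun x : EuclideanSpace ℝ (Fin n) =>
      (1 + ‖x‖ ^ ((n : ℝ) + α))⁻¹).aestronglyMeasurable) (ae_of_all _ fun x => ?_)⟩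
  rw [Real.norm_of_nonneg (by positivity), Pi.add_apply, mul_one_div, ← add_div]
  gcongr
  have := abs_add_le (v x - u x) (u x)
  rw [sub_add_cancel] at this
  linarith [hB x]

end Holder

/-! ### Passage to the limit. -/

section Limit

variable {n : ℕ} {α : ℝ}

theorem holderOnWith_of_dist_le {X Y : Type*} [PseudoMetricSpace X] [PseudoMetricSpace Y]
    {f : X → Y} {C β : NNReal} {U : Set X}
    (h : ∀ x ∈ U, ∀ y ∈ U, dist (f x) (f y) ≤ C * dist x y ^ (β : ℝ)) : HolderOnWith C β f U := by
  intro x hx y hy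
  rw [edist_dist, edist_dist, ENNReal.ofReal_rpow_of_nonneg dist_nonneg β.coe_nonneg,
    ← ENNReal.ofReal_coe_nnreal, ← ENNReal.ofReal_mul C.coe_nonneg]
  exact ENNReal.ofReal_le_ofReal (h x hx y hy)

/-- A perturbation that is locally Lipschitz preserves local Hölder continuity. -/
theorem HolderOnWith.exists_of_dist_le_add {X Y Z : Type*} [PseudoMetricSpace X]
    [PseudoMetricSpace Y] [PseudoMetricSpace Z] {f : X → Y} {g : X → Z} {C β : NNReal}
    {U : Set X} {x₀ : X} (hg : HolderOnWith C β g U) (hU : U ∈ 𝓝 x₀) (hβ : (β : ℝ) ≤ 1)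
    {L ρ : ℝ} (hL : 0 ≤ L) (hρ : 0 < ρ)
    (h : ∀ x ∈ Metric.ball x₀ ρ, ∀ y ∈ Metric.ball x₀ ρ,
      dist (f x) (f y) ≤ dist (g x) (g y) + L * dist x y) :
    ∃ C' : NNReal, ∃ U' ∈ 𝓝 x₀, HolderOnWith C' β f U' := by
  refine ⟨C + L.toNNReal, U ∩ Metric.ball x₀ (min ρ (1 / 2)),
    inter_mem hU (Metric.ball_mem_nhds _ (by positivity)), holderOnWith_of_dist_le ?_⟩
  rintro x ⟨hxU, hx⟩ y ⟨hyU, hy⟩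
  have hx2 := lt_min_iff.1 (Metric.mem_ball.1 hx)
  have hy2 := lt_min_iff.1 (Metric.mem_ball.1 hy)
  have hd : dist x y ≤ 1 := (dist_triangle_right x y x₀).trans (by linarith)
  -- The radius 1/2 keeps distances at most 1, where a Lipschitz term is dominated by the power `β ≤
  -- 1`.
  have h1 : dist x y ≤ dist x y ^ (β : ℝ) := by
    conv_lhs => rw [← Real.rpow_one (dist x y)]
    exact Real.rpow_le_rpow_of_exponent_ge' dist_nonneg hd β.2 hβ
  calc dist (f x) (f y) ≤ dist (g x) (g y) + L * dist x y := h x hx2.1 y hy2.1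
    _ ≤ C * dist x y ^ (β : ℝ) + L * dist x y ^ (β : ℝ) :=
        add_le_add (hg.dist_le hxU hyU) (mul_le_mul_of_nonneg_left h1 hL)
    _ = _ := by rw [NNReal.coe_add, Real.coe_toNNReal L hL]; ring

/-- Interior difference estimates for the difference of two `α`-harmonic functions. -/
theorem exists_local_estimate (hn : 1 ≤ n) (hα : 0 < α) (hα₂ : α < 2)
    {Ω : Set (EuclideanSpace ℝ (Fin n))} (hΩ : IsOpen Ω) {x₀ : EuclideanSpace ℝ (Fin n)}
    (hx₀ : x₀ ∈ Ω) :
    ∃ r C : ℝ, 0 < r ∧ 0 ≤ C ∧ Metric.ball x₀ (2 * r) ⊆ Ω ∧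
      ∀ (u u' : EuclideanSpace ℝ (Fin n) → ℝ) (B : ℝ), IsAlphaHarmonicOn α u Ω →
        IsAlphaHarmonicOn α u' Ω → (∀ x, |u x - u' x| ≤ B) →
        (∀ x h, x ∈ Metric.ball x₀ (2 * r) → x + h ∈ Metric.ball x₀ (2 * r) → ‖h‖ ≤ r →
          |(u (x + h) - u' (x + h)) - (u x - u' x)| ≤ C * B * ‖h‖) ∧
        (∀ x h k, x ∈ Metric.ball x₀ (2 * r) → x + h ∈ Metric.ball x₀ (2 * r) →
          x + k ∈ Metric.ball x₀ (2 * r) → x + h + k ∈ Metric.ball x₀ (2 * r) →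
          ‖h‖ ≤ r → ‖k‖ ≤ r →
          |iterDiff [h, k] (fun y => u y - u' y) x| ≤ C * B * (‖h‖ * ‖k‖)) := by
  obtain ⟨R, hR, hRΩ⟩ := Metric.isOpen_iff.1 hΩ x₀ hx₀
  have hr : 0 < R / 4 := by positivity
  -- Points in the ball of radius `2r`, each with its own ball of radius `r`, fit in the closed ball
  -- of radius `3r`, compact inside the ball of radius `R = 4r` contained in Ω.
  set r := R / 4 with hrR
  obtain ⟨C₁, hC₁, h1⟩ := exists_interior_estimate hn hα hα₂ hr le_rfl
  obtain ⟨C₂, hC₂, h2⟩ := exists_interior_estimate hn hα hα₂ hr one_le_two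
  refine ⟨r, max C₁ C₂, hr, le_max_of_le_left hC₁,
    (Metric.ball_subset_ball (by linarith)).trans hRΩ, fun u u' B hu hu' hB => ?_⟩
  have hB0 : 0 ≤ B := (abs_nonneg _).trans (hB 0)
  have hS : Metric.closedBall x₀ (3 * r) ⊆ Ω :=
    (Metric.closedBall_subset_ball (by linarith)).trans hRΩ
  have hw := hu.isBddHarmonicOn_sub hn hα hα₂ hΩ hu' hB (isCompact_closedBall x₀ (3 * r)) hS
  have hw' : ∀ x ∈ Metric.ball x₀ (2 * r),
      IsBddHarmonicOn α B (fun y => u y - u' y) (Metric.closedBall x r) := fun x hx =>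
    hw.mono (Metric.closedBall_subset_closedBall' (by linarith [Metric.mem_ball.1 hx]))
  obtain ⟨W₁, a1, b1⟩ := h1 B _ hw.aestronglyMeasurable hB
  obtain ⟨W₂, a2, b2⟩ := h2 B _ hw.aestronglyMeasurable hB
  constructor
  · intro x h hx hxh hh
    have e1 := a1 _ (hw' x hx)
    have e2 := a1 _ (hw' _ hxh)
    rw [e1, e2]
    refine (by simpa [iterDiff] using b1 [h] rfl (by simpa using hh) x :
      |W₁ (x + h) - W₁ x| ≤ C₁ * B * ‖h‖).trans ?_
    gcongr
    exact le_max_left _ _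
  · intro x h k hx hxh hxk hxhk hh hk
    have e1 := a2 _ (hw' x hx)
    have e2 := a2 _ (hw' _ hxh)
    have e3 := a2 _ (hw' _ hxk)
    have e4 := a2 _ (hw' _ hxhk)
    have e : iterDiff [h, k] (fun y => u y - u' y) x = iterDiff [h, k] W₂ x := by
      simp only [iterDiff] at *
      rw [e1, e2, e3, e4]
    rw [e]
    refine (by simpa using b2 [h, k] rfl (by simp [hh, hk]) x :
      |iterDiff [h, k] W₂ x| ≤ C₂ * B * (‖h‖ * ‖k‖)).trans ?_
    gcongr
    exact le_max_right _ _

theorem symmLaplacian_eq_zero_of_tendsto (hn : 1 ≤ n) (hα : 0 < α)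
    {w : ℕ → EuclideanSpace ℝ (Fin n) → ℝ} {w₀ : EuclideanSpace ℝ (Fin n) → ℝ}
    (hw : ∀ k, AEStronglyMeasurable (w k) volume)
    (hlim : ∀ x, Tendsto (fun k => w k x) atTop (𝓝 (w₀ x)))
    {x : EuclideanSpace ℝ (Fin n)} {s C : ℝ} (hs : α < s)
    (hC : ∀ᶠ k in atTop, ∀ h, |secondDiff (w k) x h| ≤ C * min 1 (‖h‖ ^ s))
    (h0 : ∀ᶠ k in atTop, symmLaplacian α (w k) x = 0) : symmLaplacian α w₀ x = 0 := by
  have : Tendsto (fun k => symmLaplacian α (w k) x) atTop (𝓝 (symmLaplacian α w₀ x)) := by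
    refine tendsto_integral_filter_of_dominated_convergence
      (fun h => C * (min 1 (‖h‖ ^ s) * fracKernel α h)) ?_ ?_
      ((integrable_min_mul_fracKernel hn hα hs).const_mul C) ?_
    · exact Eventually.of_forall fun k => (aestronglyMeasurable_secondDiff (hw k) x).mul
        measurable_fracKernel.aestronglyMeasurable
    · filter_upwards [hC] with k hk
      refine ae_of_all _ fun h => ?_
      rw [norm_mul, Real.norm_eq_abs, Real.norm_of_nonneg (fracKernel_nonneg h), ← mul_assoc]
      exact mul_le_mul_of_nonneg_right (hk h) (fracKernel_nonneg h)
    · exact ae_of_all _ fun h => ((((hlim x).const_mul 2).sub (hlim _)).sub (hlim _)).mul_const _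
  refine tendsto_nhds_unique this (tendsto_const_nhds.congr' ?_)
  filter_upwards [h0] with k hk using hk.symm

variable {Ω : Set (EuclideanSpace ℝ (Fin n))} {u : ℕ → EuclideanSpace ℝ (Fin n) → ℝ}
  {v : EuclideanSpace ℝ (Fin n) → ℝ}

/-- Work with `u k - u N`, bounded by 2 since both terms are within 1 of `v`. The interior estimate
with equal steps gives a quadratic bound uniform in `k`, so the symmetrized integrals converge; then
`u N` is added back. -/
theorem hasFracLaplacianAt_limit (hn : 1 ≤ n) (hα : 0 < α) (hα₂ : α < 2) (hΩ : IsOpen Ω)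
    (hu : ∀ k, IsAlphaHarmonicOn α (u k) Ω) (huv : TendstoUniformly u v atTop) {N : ℕ}
    (hN : ∀ k ≥ N, ∀ x, |v x - u k x| ≤ 1) {x : EuclideanSpace ℝ (Fin n)} (hx : x ∈ Ω) :
    HasFracLaplacianAt α v x 0 := by
  obtain ⟨r, C, hr, hC0, hrΩ, hC⟩ := exists_local_estimate hn hα hα₂ hΩ hx
  have hB : ∀ k ≥ N, ∀ y, |u k y - u N y| ≤ 2 := fun k hk y => by
    have h1 := abs_le.1 (hN k hk y)
    have h2 := abs_le.1 (hN N le_rfl y)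
    exact abs_le.2 ⟨by linarith, by linarith⟩
  have hB' : ∀ y, |v y - u N y| ≤ 2 := fun y => (hN N le_rfl y).trans one_le_two
  have hlim : ∀ y, Tendsto (fun k => u k y - u N y) atTop (𝓝 (v y - u N y)) := fun y =>
    (huv.tendsto_at y).sub_const _
  have hm : ∀ k, AEStronglyMeasurable (fun y => u k y - u N y) volume := fun k =>
    (hu k).memWeightedL1.1.sub (hu N).memWeightedL1.1
  have hm' : AEStronglyMeasurable (fun y => v y - u N y) volume :=
    aestronglyMeasurable_of_tendsto_ae atTop hm (ae_of_all _ hlim)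
  have hsd : ∀ k ≥ N, ∀ h, |secondDiff (fun y => u k y - u N y) x h| ≤
      (C * 2 + 4 * 2 / min r 1 ^ (2 : ℝ)) * min 1 (‖h‖ ^ (2 : ℝ)) := fun k hk h => by
    refine abs_secondDiff_le_min_of_local (hB k hk) two_pos (by positivity)
      (by positivity) (min_le_right _ _) (fun h hh => ?_) h
    have hhr : ‖h‖ < r := hh.trans_le (min_le_left _ _)
    have e := secondDiff_iterDiff [] (fun y => u k y - u N y) x h
    simp only [show iterDiff [] (fun y => u k y - u N y) = fun y => u k y - u N y from rfl] at e
    rw [e, abs_neg, Real.rpow_two, sq]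
    refine (hC _ _ _ (hu k) (hu N) (hB k hk)).2 _ _ _ ?_ ?_ ?_ ?_ hhr.le hhr.le <;>
      simp only [Metric.mem_ball, dist_eq_norm, sub_add_cancel, sub_self, norm_zero,
        add_sub_cancel_left, sub_sub_cancel_left, norm_neg] <;> linarith
  have hsd' : ∀ h, |secondDiff (fun y => v y - u N y) x h| ≤
      (C * 2 + 4 * 2 / min r 1 ^ (2 : ℝ)) * min 1 (‖h‖ ^ (2 : ℝ)) := fun h => by
    have : Tendsto (fun k => |secondDiff (fun y => u k y - u N y) x h|) atTop
        (𝓝 |secondDiff (fun y => v y - u N y) x h|) :=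
      ((((hlim x).const_mul 2).sub (hlim _)).sub (hlim _)).abs
    exact le_of_tendsto this ((eventually_ge_atTop N).mono fun k hk => hsd k hk h)
  have hL : symmLaplacian α (fun y => v y - u N y) x = 0 := by
    refine symmLaplacian_eq_zero_of_tendsto hn hα hm hlim hα₂
      ((eventually_ge_atTop N).mono hsd) ((eventually_ge_atTop N).mono fun k hk => ?_)
    exact ((hu k).isBddHarmonicOn_sub hn hα hα₂ hΩ (hu N) (hB k hk) isCompact_singleton
      (singleton_subset_iff.2 hx)).symmLaplacian_eq_zero x rfl
  have := ((hasFracLaplacianAt_zero_iff hn hα hα₂ hm' hB' hα₂ hsd').2 hL).add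
    ((hu N).fracLaplacian_eq_zero x hx)
  simpa using this

theorem mem_ball_of_half {x₀ x y : EuclideanSpace ℝ (Fin n)} {r : ℝ} (hr : 0 < r)
    (hx : x ∈ Metric.ball x₀ (r / 2)) (hy : y ∈ Metric.ball x₀ (r / 2)) :
    x ∈ Metric.ball x₀ (2 * r) ∧ ‖y - x‖ ≤ r := by
  rw [Metric.mem_ball] at *
  refine ⟨by linarith, ?_⟩
  rw [← dist_eq_norm]
  linarith [dist_triangle_right y x x₀]

/-- The first-difference estimate, uniform in `k`, makes `v - u N` locally Lipschitz, so `v` keeps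
the exponent of `u N`. -/
theorem isHolderLocAbove_limit_of_lt_one (hn : 1 ≤ n) (hα : 0 < α) (hα₁ : ⌊α⌋₊ = 0)
    (hα₂ : α < 2) (hΩ : IsOpen Ω)
    (hu : ∀ k, IsAlphaHarmonicOn α (u k) Ω) (huv : TendstoUniformly u v atTop) {N : ℕ}
    (hN : ∀ k ≥ N, ∀ x, |v x - u k x| ≤ 1) : IsHolderLocAbove α v Ω := by
  obtain ⟨β, hβ, hβ1, hd, hH⟩ := (hu N).holder
  refine ⟨β, hβ, hβ1, ?_⟩
  rw [hα₁] at hH ⊢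
  refine ⟨?_, fun x₀ hx₀ => ?_⟩
  · rw [Nat.cast_zero, contDiffOn_zero]
    exact huv.tendstoUniformlyOn.continuousOn (Frequently.of_forall fun k x hx =>
      ((hu k).holder.continuousAt hΩ hx).continuousWithinAt)
  · obtain ⟨C, U, hU, hCU⟩ := hH x₀ hx₀
    obtain ⟨r, L, hr, hL0, hrΩ, hL⟩ := exists_local_estimate hn hα hα₂ hΩ hx₀
    refine hCU.exists_of_dist_le_add hU hβ1.le (L := L * 2) (ρ := r / 2) (by positivity)
      (by positivity) fun x hx y hy => ?_
    rw [dist_iteratedFDeriv_zero, dist_iteratedFDeriv_zero]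
    obtain ⟨hx2, hxy⟩ := mem_ball_of_half hr hy hx
    have hy2 := (mem_ball_of_half hr hx hy).1
    have key : |(v x - u N x) - (v y - u N y)| ≤ L * 2 * ‖x - y‖ := by
      have hlim : Tendsto (fun k => |(u k x - u N x) - (u k y - u N y)|) atTop
          (𝓝 |(v x - u N x) - (v y - u N y)|) :=
        (((huv.tendsto_at x).sub_const _).sub ((huv.tendsto_at y).sub_const _)).abs
      refine le_of_tendsto hlim ((eventually_ge_atTop N).mono fun k hk => ?_)
      have := (hL (u k) (u N) 2 (hu k) (hu N) fun z => ?_).1 y (x - y) hx2 (by simpa using hy2) hxy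
      · simpa using this
      · have h1 := abs_le.1 (hN k hk z)
        have h2 := abs_le.1 (hN N le_rfl z)
        exact abs_le.2 ⟨by linarith, by linarith⟩
    rw [Real.dist_eq, Real.dist_eq, dist_eq_norm]
    have e : v x - v y = (u N x - u N y) + ((v x - u N x) - (v y - u N y)) := by ring
    rw [e]
    exact (abs_add_le _ _).trans (by linarith)

/-- Linearity of the estimates in the sup bound is used here: a small `u j - u k` has a small
gradient nearby, so the gradients converge locally uniformly. -/
theorem isHolderLocAbove_limit_of_one_le (hn : 1 ≤ n) (hα : 0 < α) (hα₁ : ⌊α⌋₊ = 1)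
    (hα₂ : α < 2) (hΩ : IsOpen Ω)
    (hu : ∀ k, IsAlphaHarmonicOn α (u k) Ω) (huv : TendstoUniformly u v atTop) {N : ℕ}
    (hN : ∀ k ≥ N, ∀ x, |v x - u k x| ≤ 1) : IsHolderLocAbove α v Ω := by
  obtain ⟨β, hβ, hβ1, -, hH⟩ := (hu N).holder
  have hβ0 : 0 < β := by
    have := (Int.fract_nonneg α).trans_lt hβ
    exact_mod_cast this
  have hdiff : ∀ k, ∀ x ∈ Ω, DifferentiableAt ℝ (u k) x := fun k x hx => by
    obtain ⟨-, -, -, hd, -⟩ := (hu k).holder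
    rw [hα₁] at hd
    exact (hd.differentiableOn (by simp)).differentiableAt (hΩ.mem_nhds hx)
  have hdist : ∀ {δ : ℝ}, 0 < δ → ∃ M, ∀ j ≥ M, ∀ k ≥ M, ∀ x, |u j x - u k x| ≤ δ :=
    fun {δ} hδ => by
    obtain ⟨M, hM⟩ := eventually_atTop.1 (Metric.tendstoUniformly_iff.1 huv (δ / 2) (by positivity))
    refine ⟨M, fun j hj k hk x => ?_⟩
    have h1 := hM j hj x
    have h2 := hM k hk x
    rw [Real.dist_eq] at h1 h2
    have h1 := abs_lt.1 h1
    have h2 := abs_lt.1 h2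
    exact abs_le.2 ⟨by linarith, by linarith⟩
  have main : ∀ x₀ ∈ Ω, DifferentiableAt ℝ v x₀ ∧
      ∃ C : NNReal, ∃ U ∈ 𝓝 x₀, HolderOnWith C β (iteratedFDeriv ℝ 1 v) U := by
    intro x₀ hx₀
    obtain ⟨r, L, hr, hL0, hrΩ, hL⟩ := exists_local_estimate hn hα hα₂ hΩ hx₀
    have hsub : Metric.ball x₀ (r / 2) ⊆ Ω :=
      (Metric.ball_subset_ball (by linarith)).trans hrΩ
    have hcauchy : UniformCauchySeqOn (fun k => fderiv ℝ (u k)) atTop (Metric.ball x₀ (r / 2)) := by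
      rw [Metric.uniformCauchySeqOn_iff]
      intro ε hε
      -- Chosen so that `L * (ε / (2 * (L + 1))) < ε`; the `+ 1` covers `L = 0`.
      obtain ⟨M, hM⟩ := hdist (δ := ε / (2 * (L + 1))) (by positivity)
      refine ⟨M, fun j hj k hk x hx => ?_⟩
      rw [dist_eq_norm]
      have h1 := (hL (u j) (u k) _ (hu j) (hu k) (hM j hj k hk)).1
      refine (((hdiff j x (hsub hx)).hasFDerivAt.sub (hdiff k x (hsub hx)).hasFDerivAt).le_of_lip'
        (C := L * (ε / (2 * (L + 1)))) (by positivity) ?_).trans_lt ?_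
      · filter_upwards [Metric.isOpen_ball.mem_nhds hx] with y hy
        have := h1 x (y - x) (mem_ball_of_half hr hx hy).1
          (by simpa using (mem_ball_of_half hr hy hx).1) (mem_ball_of_half hr hx hy).2
        simpa using this
      · rw [mul_div_assoc', div_lt_iff₀ (by positivity)]
        nlinarith
    choose! g hg using fun x (hx : x ∈ Metric.ball x₀ (r / 2)) =>
      cauchySeq_tendsto_of_complete (hcauchy.cauchySeq hx)
    have hunif := hcauchy.tendstoUniformlyOn_of_tendsto hg
    have hvd : ∀ x ∈ Metric.ball x₀ (r / 2), HasFDerivAt v (g x) x := fun x hx =>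
      hasFDerivAt_of_tendstoUniformlyOn Metric.isOpen_ball hunif
        (fun k y hy => (hdiff k y (hsub hy)).hasFDerivAt) (fun y _ => huv.tendsto_at y) hx
    have hx₀b : x₀ ∈ Metric.ball x₀ (r / 2) := Metric.mem_ball_self (by positivity)
    refine ⟨(hvd x₀ hx₀b).differentiableAt, ?_⟩
    obtain ⟨C, U, hU, hCU⟩ := hH x₀ hx₀
    rw [hα₁] at hCU
    refine hCU.exists_of_dist_le_add hU hβ1.le (L := L * 2) (ρ := r / 2) (by positivity)
      (by positivity) fun x hx y hy => ?_
    rw [dist_iteratedFDeriv_one, dist_iteratedFDeriv_one, (hvd x hx).fderiv, (hvd y hy).fderiv]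
    -- The gradient difference of `w = u k - u N` between `x` and `y` is the derivative at `y` of `z
    -- ↦ w(z + (x-y)) - w(z)`. The increments of that map are mixed second differences, at most `2L
    -- ‖x-y‖ ‖z-y‖`.
    have key : ‖(g x - fderiv ℝ (u N) x) - (g y - fderiv ℝ (u N) y)‖ ≤ L * 2 * ‖x - y‖ := by
      refine le_of_tendsto (((hg x hx).sub_const (fderiv ℝ (u N) x)).sub
        ((hg y hy).sub_const (fderiv ℝ (u N) y))).norm
        ((eventually_ge_atTop N).mono fun k hk => ?_)
      have hB : ∀ z, |u k z - u N z| ≤ 2 := fun z => by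
        have h1 := abs_le.1 (hN k hk z)
        have h2 := abs_le.1 (hN N le_rfl z)
        exact abs_le.2 ⟨by linarith, by linarith⟩
      have h2 := (hL (u k) (u N) 2 (hu k) (hu N) hB).2
      have hxy := (mem_ball_of_half hr hy hx).2
      have dx : HasFDerivAt (fun z => u k (z + (x - y)) - u N (z + (x - y)))
          (fderiv ℝ (u k) x - fderiv ℝ (u N) x) y := by
        have : HasFDerivAt (fun z => u k z - u N z) (fderiv ℝ (u k) x - fderiv ℝ (u N) x) x :=
          (hdiff k x (hsub hx)).hasFDerivAt.sub (hdiff N x (hsub hx)).hasFDerivAt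
        exact (hasFDerivAt_comp_add_right (f := fun z => u k z - u N z) (x - y)).2
          (by rwa [add_sub_cancel])
      have dy : HasFDerivAt (fun z => u k z - u N z) _ y :=
        (hdiff k y (hsub hy)).hasFDerivAt.sub (hdiff N y (hsub hy)).hasFDerivAt
      refine (dx.sub dy).le_of_lip' (by positivity) ?_
      have hcont : ContinuousAt (fun z => z + (x - y)) y := by fun_prop
      have hz' : ∀ᶠ z in 𝓝 y, z + (x - y) ∈ Metric.ball x₀ (r / 2) :=
        hcont.eventually_mem (by simpa using Metric.isOpen_ball.mem_nhds hx)
      filter_upwards [Metric.isOpen_ball.mem_nhds hy, hz'] with z hz hz'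
      have := h2 y (z - y) (x - y) (mem_ball_of_half hr hy hy).1
        (by simpa using (mem_ball_of_half hr hz hz).1)
        (by simpa using (mem_ball_of_half hr hx hx).1)
        (by simpa using (mem_ball_of_half hr hz' hz').1) (mem_ball_of_half hr hy hz).2 hxy
      simp only [iterDiff, add_sub_cancel] at this
      rw [Real.norm_eq_abs]
      convert this using 1
      · congr 1; simp only [Pi.sub_apply, add_sub_cancel y x]
      · ring
    rw [dist_eq_norm, dist_eq_norm, dist_eq_norm]
    have e : g x - g y = (fderiv ℝ (u N) x - fderiv ℝ (u N) y) +
      ((g x - fderiv ℝ (u N) x) - (g y - fderiv ℝ (u N) y)) := by abel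
    rw [e]
    exact (norm_add_le _ _).trans (by linarith)
  refine ⟨β, hβ, hβ1, ?_⟩
  rw [hα₁]
  refine ⟨?_, fun x hx => (main x hx).2⟩
  rw [Nat.cast_one, ← zero_add (1 : WithTop ℕ∞), contDiffOn_succ_iff_fderiv_of_isOpen hΩ,
    contDiffOn_zero]
  refine ⟨fun x hx => (main x hx).1.differentiableWithinAt, by simp, fun x hx => ?_⟩
  obtain ⟨C, U, hU, hC⟩ := (main x hx).2
  -- Continuity of the derivative follows from its Hölder bound, as `β > 0`.
  have h1 : HolderOnWith C β (fderiv ℝ v) U := holderOnWith_of_dist_le fun y hy z hz => by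
    rw [← dist_iteratedFDeriv_one]
    exact hC.dist_le hy hz
  exact ((h1.continuousOn hβ0).continuousAt hU).continuousWithinAt

end Limit

theorem theoremA2 (n : ℕ) (hn : 1 ≤ n) (α : ℝ) (hα₀ : 0 < α) (hα₂ : α < 2)
    (Ω : Set (EuclideanSpace ℝ (Fin n))) (hΩ : IsOpen Ω) (hΩc : IsConnected Ω)
    (u : ℕ → EuclideanSpace ℝ (Fin n) → ℝ) (v : EuclideanSpace ℝ (Fin n) → ℝ)
    (hu : ∀ k, IsAlphaHarmonicOn α (u k) Ω)
    (huv : TendstoUniformly u v atTop) :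
    IsAlphaHarmonicOn α v Ω := by
  obtain ⟨N, hN⟩ := eventually_atTop.1 (Metric.tendstoUniformly_iff.1 huv 1 one_pos)
  have hN' : ∀ k ≥ N, ∀ x, |v x - u k x| ≤ 1 := fun k hk x => (hN k hk x).le
  refine ⟨?_, ?_, fun x hx => hasFracLaplacianAt_limit hn hα₀ hα₂ hΩ hu huv hN' hx⟩
  · rcases natFloor_eq_zero_or_one hα₀ hα₂ with ⟨h, -⟩ | ⟨h, -⟩
    · exact isHolderLocAbove_limit_of_lt_one hn hα₀ h hα₂ hΩ hu huv hN'
    · exact isHolderLocAbove_limit_of_one_le hn hα₀ h hα₂ hΩ hu huv hN'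
  · exact (hu N).memWeightedL1.of_abs_sub_le hα₀
      (aestronglyMeasurable_of_tendsto_ae atTop (fun k => (hu k).memWeightedL1.1)
        (ae_of_all _ huv.tendsto_at)) (hN' N le_rfl)
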